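/- Let $\mathbb D$ be the open unit disk, $dA$ Lebesgue measure, $\mu(\Omega)=\int_\Omega (1-|z|^2)^{-2}\,dA(z)$ the hyperbolic measure of $\Omega\subset\mathbb D$. For $\alpha>-1$ let $\mathcal A^2_\alpha$ be the space of holomorphic functions $f$ on $\mathbb D$ with $\|f\|^2_{\mathcal A^2_\alpha}=\frac{\alpha+1}{\pi}\int_{\mathbb D}|f(z)|^2(1-|z|^2)^\alpha\,dA(z)<\infty$. There is an absolute constant $C>0$ such that for every $t_0\in(0,1)$ there exists $T_0\in(t_0,1)$, depending only on $t_0$, with the following property. Let $\alpha>-1$, let $f\in\mathcal A^2_\alpha$ with $\|f\|_{\mathcal A^2_\alpha}=1$, put $u(z)=|f(z)|^2(1-|z|^2)^{\alpha+2}$, let $T=\max_{\mathbb D}u$ and $\rho(t)=\mu(\{z\in\mathbb D:u(z)>t\})$. If $T\ge T_0$, then $$\rho(t)\le \pi\,\frac{1+C\,t_0^{-3}(1-T)}{T}\left(\Big(\frac{T}{t}\Big)^{\frac1{\alpha+2}}-1\right)\qquad\text{for all } t\in(t_0,T).$$ With the same $C$ and $T_0$, the same holds for $u(z)=\sum_{j\ge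 0}p_j|f_j(z)|^2(1-|z|^2)^{\alpha+2}$, where $p_j\ge 0$, $\sum_j p_j=1$, $f_j\in\mathcal A^2_\alpha$ and $\|f_j\|_{\mathcal A^2_\alpha}=1$ for all $j$; in particular for the covariant symbol of a positive semi-definite operator of trace one on $\mathcal A^2_\alpha$. -/

import Mathlib

open MeasureTheory

noncomputable section

/-- The open unit disk. -/
def unitDisk : Set ℂ := Metric.ball (0 : ℂ) 1

/-- Membership in the weighted Bergman space `A²_α`: holomorphic in the disk, with `|f|²`
integrable against `(1 - |z|²)^α dA`. -/
def MemBergman (α : ℝ) (f : ℂ → ℂ) : Prop :=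
  DifferentiableOn ℂ f unitDisk ∧
    IntegrableOn (fun z : ℂ => ‖f z‖ ^ 2 * (1 - ‖z‖ ^ 2) ^ α) unitDisk volume

/-- The norm of the weighted Bergman space `A²_α`. -/
def bergmanNorm (α : ℝ) (f : ℂ → ℂ) : ℝ :=
  Real.sqrt ((α + 1) / Real.pi * ∫ z in unitDisk, ‖f z‖ ^ 2 * (1 - ‖z‖ ^ 2) ^ α)

/-- The hyperbolic measure `dA(z) / (1 - |z|²)²` on the disk. -/
def hyperbolicMeasure : Measure ℂ :=
  (volume.restrict unitDisk).withDensity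
    (fun z : ℂ => ENNReal.ofReal (1 / (1 - ‖z‖ ^ 2) ^ 2))

/-- The function `u(z) = |f(z)|² (1 - |z|²)^(α+2)`. -/
def bergmanDensity (α : ℝ) (f : ℂ → ℂ) (z : ℂ) : ℝ :=
  ‖f z‖ ^ 2 * (1 - ‖z‖ ^ 2) ^ (α + 2)

/-- The function `u(z) = ∑ⱼ pⱼ |fⱼ(z)|² (1 - |z|²)^(α+2)`, the covariant symbol
`⟨κ_z, A κ_z⟩` of the operator `A = ∑ⱼ pⱼ ⟨·, fⱼ⟩ fⱼ`. -/
def covariantSymbol (α : ℝ) (p : ℕ → ℝ) (f : ℕ → ℂ → ℂ) (z : ℂ) : ℝ :=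
  ∑' j, p j * bergmanDensity α (f j) z

/-- The distribution function `ρ(t)`: the hyperbolic measure of `{z ∈ 𝔻 : u(z) > t}`. -/
def superlevelMeasure (u : ℂ → ℝ) (t : ℝ) : ENNReal :=
  hyperbolicMeasure {z : ℂ | z ∈ unitDisk ∧ t < u z}

end

/-!
Let `F` be holomorphic in the disk with values in a Hilbert space, `u(z) = ‖F z‖² (1 - |z|²)^β` with
`β = α + 2`. By Möbius invariance the maximum may be moved to the origin, so that `‖F 0‖² = T`.
A function of norm at most one satisfies `∑ ‖cₙ‖² / binom(β + n - 1, n) ≤ 1` for its Taylor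
coefficients `cₙ`, and the constant term already takes up `T`, so the Cauchy-Schwarz inequality
bounds `‖F z - F 0‖²` by `(1 - T) ((1 - |z|²)^(-β) - 1)`. Hence `{u > t}` is contained in a
perturbation of the disk `{(1 - |z|²)^(-β) < T / t}`. The term of first order in `F - F 0` is the
real part of a holomorphic function vanishing to second order at `0`, since the origin is a critical
point. On every ray it may be replaced by its value on the boundary circle of the unperturbed disk,
with an error of order `1 - T`, and on that circle the mean value property makes its contribution to
the hyperbolic area vanish.

For an operator `∑ⱼ pⱼ ⟨·, fⱼ⟩ fⱼ` the same argument applies to the function `(√pⱼ fⱼ)ⱼ` with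
values in `ℓ²`.
-/

section UnitDisk

lemma mem_unitDisk {z : ℂ} : z ∈ unitDisk ↔ ‖z‖ < 1 := by simp [unitDisk]

lemma isOpen_unitDisk : IsOpen unitDisk := Metric.isOpen_ball

lemma zero_mem_unitDisk : (0 : ℂ) ∈ unitDisk := by simp [mem_unitDisk]

lemma one_sub_norm_sq_pos {z : ℂ} (hz : z ∈ unitDisk) : 0 < 1 - ‖z‖ ^ 2 := by
  nlinarith [norm_nonneg z, mem_unitDisk.1 hz]

lemma closedBall_subset_unitDisk {r : ℝ} (hr : |r| < 1) : Metric.closedBall 0 |r| ⊆ unitDisk :=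
  Metric.closedBall_subset_ball hr

lemma sphere_subset_unitDisk {r : ℝ} (hr : |r| < 1) : Metric.sphere 0 |r| ⊆ unitDisk :=
  Metric.sphere_subset_closedBall.trans (closedBall_subset_unitDisk hr)

lemma differentiableOn_dslope_unitDisk {E : Type*} [NormedAddCommGroup E] [NormedSpace ℂ E]
    [CompleteSpace E] {F : ℂ → E} (hF : DifferentiableOn ℂ F unitDisk) :
    DifferentiableOn ℂ (dslope F 0) unitDisk :=
  (Complex.differentiableOn_dslope (isOpen_unitDisk.mem_nhds zero_mem_unitDisk)).2 hF

end UnitDisk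

section NegativeBinomialCoefficients

lemma factorial_mul_multichoose (β : ℝ) (n : ℕ) :
    n.factorial * Ring.multichoose β n = (ascPochhammer ℝ n).eval β := by
  rw [← nsmul_eq_mul, Ring.factorial_nsmul_multichoose_eq_ascPochhammer,
    Polynomial.ascPochhammer_smeval_eq_eval]

lemma multichoose_pos {β : ℝ} (hβ : 0 < β) (n : ℕ) : 0 < Ring.multichoose β n :=
  pos_of_mul_pos_right (factorial_mul_multichoose β n ▸ ascPochhammer_pos n β hβ)
    (Nat.cast_nonneg _)

lemma succ_mul_multichoose_succ_eq_mul_multichoose_add_one (β : ℝ) (n : ℕ) :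
    (n + 1) * Ring.multichoose β (n + 1) = β * Ring.multichoose (β + 1) n := by
  have hn : (n.factorial : ℝ) ≠ 0 := mod_cast n.factorial_ne_zero
  have h := factorial_mul_multichoose β (n + 1)
  rw [ascPochhammer_succ_left, Polynomial.eval_mul, Polynomial.eval_X, Polynomial.eval_comp,
    Polynomial.eval_add, Polynomial.eval_X, Polynomial.eval_one, ← factorial_mul_multichoose,
    Nat.factorial_succ] at h
  push_cast at h
  exact mul_left_cancel₀ hn (by linarith)

lemma hasSum_multichoose_mul_pow (β : ℝ) {x : ℝ} (hx : |x| < 1) :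
    HasSum (fun n => Ring.multichoose β n * x ^ n) ((1 - x) ^ (-β)) := by
  have hx' : x ∈ Metric.eball (0 : ℝ) 1 := by simpa [enorm_eq_nnnorm] using! hx
  have h := (Real.one_div_one_sub_rpow_hasFPowerSeriesOnBall_zero β).hasSum_sub hx'
  rw [one_div, ← Real.rpow_neg (sub_nonneg.2 (abs_lt.1 hx).2.le)] at h
  simpa only [FormalMultilinearSeries.ofScalars_apply_eq, sub_zero, smul_eq_mul,
    ← Ring.multichoose_eq] using h

lemma succ_succ_sq_mul_multichoose_le {β : ℝ} (hβ : 0 < β) (n : ℕ) :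
    (n + 2) ^ 2 * Ring.multichoose β (n + 2) ≤
      2 * β * (β + 1) * Ring.multichoose (β + 2) n := by
  have h₁ := succ_mul_multichoose_succ_eq_mul_multichoose_add_one β (n + 1)
  have h₂ := succ_mul_multichoose_succ_eq_mul_multichoose_add_one (β + 1) n
  have hpos : 0 < Ring.multichoose (β + 1) (n + 1) := multichoose_pos (by linarith) _
  push_cast at h₁ h₂
  rw [show β + 1 + 1 = β + 2 by ring] at h₂
  calc ((n : ℝ) + 2) ^ 2 * Ring.multichoose β (n + 2)
      = (n + 2) * (β * Ring.multichoose (β + 1) (n + 1)) := by rw [← h₁]; ring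
    _ ≤ 2 * (n + 1) * (β * Ring.multichoose (β + 1) (n + 1)) := by
        gcongr; linarith [(n.cast_nonneg : (0 : ℝ) ≤ n)]
    _ = 2 * β * (β + 1) * Ring.multichoose (β + 2) n := by linear_combination 2 * β * h₂

lemma hasSum_multichoose_mul_norm_sq_pow (β : ℝ) {z : ℂ} (hz : z ∈ unitDisk) :
    HasSum (fun n => Ring.multichoose β n * (‖z‖ ^ 2) ^ n) ((1 - ‖z‖ ^ 2) ^ (-β)) :=
  hasSum_multichoose_mul_pow β <| by
    rw [abs_of_nonneg (sq_nonneg _)]; linarith [one_sub_norm_sq_pos hz]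

end NegativeBinomialCoefficients

section TaylorCoefficients

lemma norm_sq_le_tsum_mul_of_hasSum {ι E : Type*} [SeminormedAddCommGroup E] {a : ι → E}
    {m w : ι → ℝ} {S : E} {W : ℝ} (ha : HasSum a S) (hm : Summable m) (hw : HasSum w W)
    (hm0 : ∀ i, 0 ≤ m i) (hw0 : ∀ i, 0 ≤ w i) (h : ∀ i, ‖a i‖ ^ 2 ≤ m i * w i) :
    ‖S‖ ^ 2 ≤ (∑' i, m i) * W := by
  refine le_of_tendsto (ha.norm.pow 2) (.of_forall fun s => ?_)
  calc ‖∑ i ∈ s, a i‖ ^ 2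
      ≤ (∑ i ∈ s, ‖a i‖) ^ 2 := by gcongr; exact norm_sum_le _ _
    _ ≤ (∑ i ∈ s, m i) * ∑ i ∈ s, w i :=
        Finset.sum_sq_le_sum_mul_sum_of_sq_le_mul s (fun i _ => hm0 i) (fun i _ => hw0 i)
          fun i _ => h i
    _ ≤ (∑' i, m i) * W :=
        mul_le_mul (hm.sum_le_tsum s fun i _ => hm0 i)
          (hw.tsum_eq ▸ hw.summable.sum_le_tsum s fun i _ => hw0 i)
          (Finset.sum_nonneg fun i _ => hw0 i) (tsum_nonneg hm0)

variable {E : Type*} [NormedAddCommGroup E] [NormedSpace ℂ E]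

/-- The `n`-th Taylor coefficient at the origin. -/
noncomputable def taylorCoeff (F : ℂ → E) (n : ℕ) : E := (n.factorial : ℂ)⁻¹ • iteratedDeriv n F 0

@[simp]
lemma taylorCoeff_zero (F : ℂ → E) : taylorCoeff F 0 = F 0 := by simp [taylorCoeff]

lemma taylorCoeff_deriv (F : ℂ → E) (n : ℕ) :
    taylorCoeff (deriv F) n = ((n : ℂ) + 1) • taylorCoeff F (n + 1) := by
  have h : (n : ℂ) + 1 ≠ 0 := Nat.cast_add_one_ne_zero n
  simp only [taylorCoeff, iteratedDeriv_succ', Nat.factorial_succ, smul_smul]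
  congr 1
  push_cast
  field_simp

variable [CompleteSpace E]

lemma hasSum_pow_smul_taylorCoeff {F : ℂ → E} (hF : DifferentiableOn ℂ F unitDisk) {z : ℂ}
    (hz : z ∈ unitDisk) : HasSum (fun n => z ^ n • taylorCoeff F n) (F z) := by
  simpa only [sub_zero, taylorCoeff, smul_comm (z ^ _)] using
    Complex.hasSum_taylorSeries_on_ball hF hz

lemma taylorCoeff_eq_coeff {F : ℂ → E} {p : FormalMultilinearSeries ℂ ℂ E}
    (hp : HasFPowerSeriesAt F p 0) (n : ℕ) : taylorCoeff F n = p.coeff n := by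
  obtain ⟨r, hr⟩ := hp
  have h := hr.factorial_smul 1 n
  rw [← iteratedDeriv_eq_iteratedFDeriv, ← Nat.cast_smul_eq_nsmul ℂ] at h
  rw [taylorCoeff, ← h, inv_smul_smul₀ (mod_cast n.factorial_ne_zero)]
  rfl

lemma taylorCoeff_dslope {F : ℂ → E} (hF : AnalyticAt ℂ F 0) (n : ℕ) :
    taylorCoeff (dslope F 0) n = taylorCoeff F (n + 1) := by
  obtain ⟨p, hp⟩ := hF
  rw [taylorCoeff_eq_coeff hp.has_fpower_series_dslope_fslope, taylorCoeff_eq_coeff hp,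
    FormalMultilinearSeries.coeff_fslope]

end TaylorCoefficients

section TaylorTermEstimates

lemma add_one_mul_rpow_neg_add_two_le {β x : ℝ} (hβ : 1 ≤ β) (hx : 0 < x) (hx1 : x ≤ 1) :
    2 * β * (β + 1) * x ^ (-(β + 2)) ≤ (2 * β * x ^ (-(β + 1))) ^ 2 := by
  rw [mul_pow, ← Real.rpow_natCast (x ^ _), ← Real.rpow_mul hx.le]
  have hrpow : x ^ (-(β + 2)) ≤ x ^ (-(β + 1) * (2 : ℕ)) :=
    Real.rpow_le_rpow_of_exponent_ge hx hx1 (by push_cast; linarith)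
  exact mul_le_mul (by nlinarith) hrpow (by positivity) (by positivity)

variable {E : Type*} [NormedAddCommGroup E] [NormedSpace ℂ E]

/-- The squared norm of the `n`-th Taylor term of `F` in the Bergman space `A²_(β-2)`, in which
`‖zⁿ‖² = 1 / Ring.multichoose β n`. -/
noncomputable def taylorTermNormSq (β : ℝ) (F : ℂ → E) (n : ℕ) : ℝ :=
  ‖taylorCoeff F n‖ ^ 2 / Ring.multichoose β n

variable {β : ℝ} {F : ℂ → E}

lemma taylorTermNormSq_nonneg (hβ : 0 < β) (F : ℂ → E) (n : ℕ) : 0 ≤ taylorTermNormSq β F n :=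
  div_nonneg (sq_nonneg _) (multichoose_pos hβ n).le

lemma norm_taylorCoeff_sq (hβ : 0 < β) (F : ℂ → E) (n : ℕ) :
    ‖taylorCoeff F n‖ ^ 2 = taylorTermNormSq β F n * Ring.multichoose β n :=
  (div_mul_cancel₀ _ (multichoose_pos hβ n).ne').symm

lemma taylorTermNormSq_zero (β : ℝ) (F : ℂ → E) : taylorTermNormSq β F 0 = ‖F 0‖ ^ 2 := by
  simp [taylorTermNormSq]

lemma norm_sq_pow_smul (z : ℂ) (n : ℕ) (v : E) : ‖z ^ n • v‖ ^ 2 = ‖v‖ ^ 2 * (‖z‖ ^ 2) ^ n := by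
  rw [norm_smul, norm_pow]; ring

variable [CompleteSpace E]

theorem norm_sq_le_tsum_taylorTermNormSq_mul (hβ : 0 < β) (hF : DifferentiableOn ℂ F unitDisk)
    (hs : Summable (taylorTermNormSq β F)) {z : ℂ} (hz : z ∈ unitDisk) :
    ‖F z‖ ^ 2 ≤ (∑' n, taylorTermNormSq β F n) * (1 - ‖z‖ ^ 2) ^ (-β) := by
  refine norm_sq_le_tsum_mul_of_hasSum (hasSum_pow_smul_taylorCoeff hF hz) hs
    (hasSum_multichoose_mul_norm_sq_pow β hz) (taylorTermNormSq_nonneg hβ F)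
    (fun n => mul_nonneg (multichoose_pos hβ n).le (by positivity)) fun n => ?_
  rw [norm_sq_pow_smul, norm_taylorCoeff_sq hβ, mul_assoc]

theorem norm_sub_sq_le_tsum_taylorTermNormSq_mul (hβ : 0 < β)
    (hF : DifferentiableOn ℂ F unitDisk) (hs : Summable (taylorTermNormSq β F)) {z : ℂ}
    (hz : z ∈ unitDisk) :
    ‖F z - F 0‖ ^ 2 ≤ (∑' n, taylorTermNormSq β F (n + 1)) * ((1 - ‖z‖ ^ 2) ^ (-β) - 1) := by
  have hsum : HasSum (fun n => z ^ (n + 1) • taylorCoeff F (n + 1)) (F z - F 0) := by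
    simpa using (hasSum_nat_add_iff' 1).2 (hasSum_pow_smul_taylorCoeff hF hz)
  have hsumW : HasSum (fun n => Ring.multichoose β (n + 1) * (‖z‖ ^ 2) ^ (n + 1))
      ((1 - ‖z‖ ^ 2) ^ (-β) - 1) := by
    simpa using (hasSum_nat_add_iff' 1).2 (hasSum_multichoose_mul_norm_sq_pow β hz)
  refine norm_sq_le_tsum_mul_of_hasSum hsum ((summable_nat_add_iff 1).2 hs) hsumW
    (fun n => taylorTermNormSq_nonneg hβ F _)
    (fun n => mul_nonneg (multichoose_pos hβ _).le (by positivity)) fun n => ?_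
  rw [norm_sq_pow_smul, norm_taylorCoeff_sq hβ, mul_assoc]

theorem norm_deriv_sub_sq_le_tsum_taylorTermNormSq_mul (hβ : 0 < β)
    (hF : DifferentiableOn ℂ F unitDisk) (hs : Summable (taylorTermNormSq β F)) {z : ℂ}
    (hz : z ∈ unitDisk) :
    ‖deriv F z - deriv F 0‖ ^ 2 ≤ (∑' n, taylorTermNormSq β F (n + 2)) *
      (2 * β * (β + 1) * ‖z‖ ^ 2 * (1 - ‖z‖ ^ 2) ^ (-(β + 2))) := by
  have hsum : HasSum (fun n => z ^ (n + 1) • taylorCoeff (deriv F) (n + 1))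
      (deriv F z - deriv F 0) := by
    simpa using
      (hasSum_nat_add_iff' 1).2 (hasSum_pow_smul_taylorCoeff (hF.deriv isOpen_unitDisk) hz)
  refine norm_sq_le_tsum_mul_of_hasSum hsum ((summable_nat_add_iff 2).2 hs)
    ((hasSum_multichoose_mul_norm_sq_pow (β + 2) hz).mul_left _)
    (fun n => taylorTermNormSq_nonneg hβ F _)
    (fun n => by have := multichoose_pos (show 0 < β + 2 by linarith) n; positivity) fun n => ?_
  calc ‖z ^ (n + 1) • taylorCoeff (deriv F) (n + 1)‖ ^ 2
      = taylorTermNormSq β F (n + 2) * (((n + 2) ^ 2 * Ring.multichoose β (n + 2)) *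
          (‖z‖ ^ 2) ^ (n + 1)) := by
        rw [norm_sq_pow_smul, taylorCoeff_deriv, norm_smul, mul_pow, norm_taylorCoeff_sq hβ,
          show ((n + 1 : ℕ) : ℂ) + 1 = ((n + 2 : ℕ) : ℂ) by push_cast; ring, Complex.norm_natCast]
        push_cast
        ring
    _ ≤ taylorTermNormSq β F (n + 2) * ((2 * β * (β + 1) * Ring.multichoose (β + 2) n) *
          (‖z‖ ^ 2) ^ (n + 1)) := by
        gcongr _ * (?_ * _)
        · exact taylorTermNormSq_nonneg hβ F _
        · exact succ_succ_sq_mul_multichoose_le hβ n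
    _ = _ := by ring

/-- The last factor is the derivative of `(1 - r²)^(-β)` at `r = ‖z‖`, so that the bound integrates
along rays. -/
theorem norm_deriv_sub_le_sqrt_tsum_mul (hβ : 1 ≤ β)
    (hF : DifferentiableOn ℂ F unitDisk) (hs : Summable (taylorTermNormSq β F)) {z : ℂ}
    (hz : z ∈ unitDisk) :
    ‖deriv F z - deriv F 0‖ ≤ √(∑' n, taylorTermNormSq β F (n + 2)) *
      (2 * β * ‖z‖ * (1 - ‖z‖ ^ 2) ^ (-(β + 1))) := by
  have hx := one_sub_norm_sq_pos hz
  have hβ0 : 0 < β := by linarith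
  have hE : 0 ≤ ∑' n, taylorTermNormSq β F (n + 2) :=
    tsum_nonneg fun n => taylorTermNormSq_nonneg hβ0 F _
  refine le_of_sq_le_sq ?_ (by positivity)
  calc ‖deriv F z - deriv F 0‖ ^ 2
      ≤ _ := norm_deriv_sub_sq_le_tsum_taylorTermNormSq_mul hβ0 hF hs hz
    _ = (∑' n, taylorTermNormSq β F (n + 2)) *
          (‖z‖ ^ 2 * (2 * β * (β + 1) * (1 - ‖z‖ ^ 2) ^ (-(β + 2)))) := by ring
    _ ≤ (∑' n, taylorTermNormSq β F (n + 2)) *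
          (‖z‖ ^ 2 * (2 * β * (1 - ‖z‖ ^ 2) ^ (-(β + 1))) ^ 2) := by
        gcongr
        exact add_one_mul_rpow_neg_add_two_le hβ hx (by linarith [sq_nonneg ‖z‖])
    _ = _ := by rw [mul_pow √_, Real.sq_sqrt hE]; ring

end TaylorTermEstimates

section CriticalPoints

variable {E : Type*} [NormedAddCommGroup E] [InnerProductSpace ℂ E]

lemma norm_sq_eq_norm_sq_add_re_inner_add (v w : E) :
    ‖w‖ ^ 2 = ‖v‖ ^ 2 + 2 * (inner ℂ v (w - v)).re + ‖w - v‖ ^ 2 := by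
  have h := norm_add_sq (𝕜 := ℂ) v (w - v)
  rwa [add_sub_cancel] at h

lemma hasDerivAt_norm_sq_mul_rpow_radial {F : ℂ → E} (hF : DifferentiableAt ℂ F 0) (β : ℝ)
    (w : ℂ) :
    HasDerivAt (fun ε : ℝ => ‖F (ε * w)‖ ^ 2 * (1 - ‖(ε : ℂ) * w‖ ^ 2) ^ β)
      (2 * (w * inner ℂ (F 0) (deriv F 0)).re) 0 := by
  have hline : HasDerivAt (fun ε : ℝ => (ε : ℂ) * w) w 0 := by
    simpa using (Complex.ofRealCLM.hasDerivAt (x := (0 : ℝ))).mul_const w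
  have hFline : HasDerivAt (fun ε : ℝ => F (ε * w)) (w • deriv F 0) 0 :=
    HasDerivAt.scomp (0 : ℝ) (by simpa using hF.hasDerivAt) hline
  have hnorm : HasDerivAt (fun ε : ℝ => ‖F (ε * w)‖ ^ 2)
      (2 * (w * inner ℂ (F 0) (deriv F 0)).re) 0 := by
    let : InnerProductSpace ℝ E := .complexToReal
    convert hFline.norm_sq using 2
    simp [real_inner_eq_re_inner ℂ, inner_smul_right]
  have hweight : HasDerivAt (fun ε : ℝ => (1 - ‖(ε : ℂ) * w‖ ^ 2) ^ β) 0 0 := by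
    have h := (hline.norm_sq.const_sub 1).rpow_const (p := β) (.inl (by simp))
    simpa using h
  simpa using hnorm.fun_mul hweight

lemma inner_deriv_eq_zero_of_isLocalMax {F : ℂ → E} (hF : DifferentiableAt ℂ F 0) {β : ℝ}
    (hmax : IsLocalMax (fun z => ‖F z‖ ^ 2 * (1 - ‖z‖ ^ 2) ^ β) 0) :
    inner ℂ (F 0) (deriv F 0) = 0 := by
  set κ := inner ℂ (F 0) (deriv F 0)
  have hcont : Filter.Tendsto (fun ε : ℝ => (ε : ℂ) * star κ) (nhds 0) (nhds 0) :=
    Continuous.tendsto' (by fun_prop) _ _ (by simp)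
  have hcrit := IsLocalMax.hasDerivAt_eq_zero
    (f := fun ε : ℝ => ‖F (ε * star κ)‖ ^ 2 * (1 - ‖(ε : ℂ) * star κ‖ ^ 2) ^ β) (a := 0)
    (by simpa [IsLocalMax, IsMaxFilter] using hcont.eventually hmax)
    (hasDerivAt_norm_sq_mul_rpow_radial hF β _)
  rw [Complex.star_def, ← Complex.normSq_eq_conj_mul_self, Complex.ofReal_re] at hcrit
  exact Complex.normSq_eq_zero.1 (by linarith)

end CriticalPoints

section CircleAverages

open Set Real

lemma setLIntegral_unitDisk_eq_polar (g : ℂ → ENNReal) :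
    ∫⁻ z in unitDisk, g z =
      ∫⁻ p in Ioo 0 1 ×ˢ Ioo (-π) π, ENNReal.ofReal p.1 * g (circleMap 0 p.1 p.2) := by
  have hset : Ioo 0 1 ×ˢ Ioo (-π) π = (Iio 1 ×ˢ univ) ∩ polarCoord.target := by
    ext p
    simp only [polarCoord_target, mem_prod, mem_inter_iff, mem_Ioo, mem_Iio, mem_Ioi, mem_univ]
    tauto
  rw [← lintegral_indicator isOpen_unitDisk.measurableSet,
    ← Complex.lintegral_comp_polarCoord_symm, hset,
    ← setLIntegral_indicator (measurableSet_Iio.prod .univ)]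
  refine setLIntegral_congr_fun polarCoord.open_target.measurableSet fun p hp => ?_
  have hp0 : 0 < p.1 := hp.1
  have hsymm : Complex.polarCoord.symm p = circleMap 0 p.1 p.2 := by
    simp [circleMap, Complex.exp_mul_I]
  by_cases hp1 : p.1 < 1 <;> simp [indicator, hsymm, mem_unitDisk, abs_of_pos hp0, hp1]

lemma lintegral_circleMap_ofReal {f : ℂ → ℝ} {c : ℂ} {r : ℝ}
    (hf : ContinuousOn f (Metric.sphere c |r|)) (hf0 : ∀ z ∈ Metric.sphere c |r|, 0 ≤ f z) :
    ∫⁻ θ in Ioo (-π) π, ENNReal.ofReal (f (circleMap c r θ)) =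
      ENNReal.ofReal (2 * π * circleAverage f c r) := by
  have hcont : Continuous fun θ => f (circleMap c r θ) :=
    hf.comp_continuous (continuous_circleMap c r) (circleMap_mem_sphere' c r)
  have hper : Function.Periodic (fun θ => f (circleMap c r θ)) (2 * π) :=
    (periodic_circleMap c r).comp f
  have havg : 2 * π * circleAverage f c r = ∫ θ in -π..π, f (circleMap c r θ) := by
    rw [circleAverage_def, smul_eq_mul, mul_inv_cancel_left₀ two_pi_pos.ne']
    convert hper.intervalIntegral_add_eq 0 (-π) using 2 <;> ring
  rw [havg, intervalIntegral.integral_of_le (by linarith [pi_pos]), integral_Ioc_eq_integral_Ioo,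
    ofReal_integral_eq_lintegral_ofReal (hcont.integrableOn_Icc.mono_set Ioo_subset_Icc_self)
      (.of_forall fun θ => hf0 _ (circleMap_mem_sphere' c r θ))]

lemma circleAverage_re_eq_re {h : ℂ → ℂ} (hh : DifferentiableOn ℂ h unitDisk) {r : ℝ}
    (hr : |r| < 1) :
    circleAverage (fun z => (h z).re) 0 r = (h 0).re := by
  have hint : CircleIntegrable h 0 r :=
    (hh.continuousOn.mono (sphere_subset_unitDisk hr)).circleIntegrable'
  have hmean : circleAverage h 0 r = h 0 :=
    (hh.diffContOnCl_ball (closedBall_subset_unitDisk hr)).circleAverage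
  rw [← hmean, ← Complex.reCLM_apply, ← Complex.reCLM.circleAverage_comp_comm hint]
  rfl

variable {E : Type*} [NormedAddCommGroup E] [InnerProductSpace ℂ E] [CompleteSpace E] {F : ℂ → E}
  {r : ℝ}

lemma circleAverage_norm_sq (hF : DifferentiableOn ℂ F unitDisk) (hr : |r| < 1) :
    circleAverage (fun z => ‖F z‖ ^ 2) 0 r =
      ‖F 0‖ ^ 2 + r ^ 2 * circleAverage (fun z => ‖dslope F 0 z‖ ^ 2) 0 r := by
  have hG : ContinuousOn (dslope F 0) unitDisk :=
    (differentiableOn_dslope_unitDisk hF).continuousOn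
  have hinner : DifferentiableOn ℂ (fun z => inner ℂ (F 0) (F z - F 0)) unitDisk :=
    (innerSL ℂ (F 0)).differentiable.comp_differentiableOn (hF.sub_const _)
  have hexpand : EqOn (fun z => ‖F z‖ ^ 2) (fun z => ‖F 0‖ ^ 2 +
      2 * (inner ℂ (F 0) (F z - F 0)).re + r ^ 2 * ‖dslope F 0 z‖ ^ 2) (Metric.sphere 0 |r|) := by
    intro z hz
    have hz : ‖z‖ = |r| := by simpa using hz
    have hsub : F z - F 0 = z • dslope F 0 z := by simpa using (sub_smul_dslope F 0 z).symm
    have hnorm : ‖F z - F 0‖ ^ 2 = r ^ 2 * ‖dslope F 0 z‖ ^ 2 := by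
      rw [hsub, norm_smul, hz, mul_pow, sq_abs]
    simp only [norm_sq_eq_norm_sq_add_re_inner_add (F 0) (F z), hnorm]
  have hint₁ : CircleIntegrable (fun z => 2 * (inner ℂ (F 0) (F z - F 0)).re) 0 r :=
    ContinuousOn.circleIntegrable' <| (continuousOn_const.mul <|
      Complex.continuous_re.comp_continuousOn hinner.continuousOn).mono <|
        sphere_subset_unitDisk hr
  have hint₂ : CircleIntegrable (fun z => r ^ 2 * ‖dslope F 0 z‖ ^ 2) 0 r :=
    ContinuousOn.circleIntegrable' <|
      (continuousOn_const.mul (hG.norm.pow 2)).mono (sphere_subset_unitDisk hr)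
  have hconst : CircleIntegrable (fun _ => ‖F 0‖ ^ 2) 0 r := circleIntegrable_const _ _ _
  rw [circleAverage_congr_sphere hexpand, circleAverage_fun_add (hconst.fun_add hint₁) hint₂,
    circleAverage_fun_add hconst hint₁, circleAverage_const]
  simp only [← smul_eq_mul, circleAverage_fun_smul, circleAverage_re_eq_re hinner hr]
  simp

lemma sum_norm_taylorCoeff_sq_mul_pow_le_circleAverage (N : ℕ)
    {F : ℂ → E} (hF : DifferentiableOn ℂ F unitDisk) (hr : |r| < 1) :
    ∑ n ∈ Finset.range N, ‖taylorCoeff F n‖ ^ 2 * (r ^ 2) ^ n ≤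
      circleAverage (fun z => ‖F z‖ ^ 2) 0 r := by
  induction N generalizing F with
  | zero => simpa using circleAverage_nonneg_of_nonneg fun z _ => sq_nonneg ‖F z‖
  | succ N ih =>
    have hF0 : AnalyticAt ℂ F 0 := hF.analyticAt (isOpen_unitDisk.mem_nhds zero_mem_unitDisk)
    calc ∑ n ∈ Finset.range (N + 1), ‖taylorCoeff F n‖ ^ 2 * (r ^ 2) ^ n
        = ‖F 0‖ ^ 2 + r ^ 2 *
            ∑ n ∈ Finset.range N, ‖taylorCoeff (dslope F 0) n‖ ^ 2 * (r ^ 2) ^ n := by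
          rw [Finset.sum_range_succ', Finset.mul_sum, add_comm]
          congr 1
          · simp
          · exact Finset.sum_congr rfl fun n _ => by rw [taylorCoeff_dslope hF0]; ring
      _ ≤ _ := by
          rw [circleAverage_norm_sq hF hr]
          gcongr
          exact ih (differentiableOn_dslope_unitDisk hF)

end CircleAverages

section BetaIntegrals

open Set Real ProbabilityTheory

lemma beta_natCast_succ_mul_multichoose {s : ℝ} (hs : 0 < s) (n : ℕ) :
    beta (n + 1) s * (s * Ring.multichoose (s + 1) n) = 1 := by
  have hΓ : ∀ m : ℕ, Gamma (s + m + 1) = s * Gamma s * (ascPochhammer ℝ m).eval (s + 1) := by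
    intro m
    induction m with
    | zero => simp [Gamma_add_one hs.ne']
    | succ m ih =>
      rw [show s + (m + 1 : ℕ) + 1 = s + m + 1 + 1 by push_cast; ring,
        Gamma_add_one (by positivity), ih, ascPochhammer_succ_eval]
      ring
  have hne : Gamma (s + n + 1) ≠ 0 := (Gamma_pos_of_pos (by positivity)).ne'
  rw [beta, Gamma_nat_eq_factorial, show (n : ℝ) + 1 + s = s + n + 1 by ring, div_mul_eq_mul_div,
    div_eq_one_iff_eq hne, hΓ n, ← factorial_mul_multichoose]
  ring

lemma lintegral_pow_mul_one_sub_rpow {α : ℝ} (hα : -1 < α) (n : ℕ) :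
    ∫⁻ x in Ioo (0 : ℝ) 1, ENNReal.ofReal (x ^ n * (1 - x) ^ α) =
      ENNReal.ofReal (1 / ((α + 1) * Ring.multichoose (α + 2) n)) := by
  have hα1 : 0 < α + 1 := by linarith
  have hb : 0 < beta (n + 1) (α + 1) := beta_pos (by positivity) hα1
  have hbeta : 1 / ((α + 1) * Ring.multichoose (α + 2) n) = beta (n + 1) (α + 1) := by
    have h := beta_natCast_succ_mul_multichoose hα1 n
    rw [show α + 1 + 1 = α + 2 by ring] at h
    exact (eq_one_div_of_mul_eq_one_left h).symm
  have hpdf : ∀ x : ℝ, x ^ n * (1 - x) ^ α = beta (n + 1) (α + 1) *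
      (1 / beta (n + 1) (α + 1) * x ^ ((n : ℝ) + 1 - 1) * (1 - x) ^ (α + 1 - 1)) := by
    intro x
    rw [add_sub_cancel_right, add_sub_cancel_right, rpow_natCast]
    field_simp
  simp only [hbeta, hpdf, ENNReal.ofReal_mul hb.le]
  rw [lintegral_const_mul' _ _ ENNReal.ofReal_ne_top, ← lintegral_betaPDF,
    lintegral_betaPDF_eq_one (by positivity) hα1, mul_one]

lemma lintegral_pow_mul_one_sub_sq_rpow {α : ℝ} (hα : -1 < α) (n : ℕ) :
    ∫⁻ r in Ioo (0 : ℝ) 1, ENNReal.ofReal (2 * r * ((r ^ 2) ^ n * (1 - r ^ 2) ^ α)) =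
      ENNReal.ofReal (1 / ((α + 1) * Ring.multichoose (α + 2) n)) := by
  have himage : (fun r : ℝ => r ^ 2) '' Ioo 0 1 = Ioo 0 1 := by
    ext x
    constructor
    · rintro ⟨r, hr, rfl⟩
      exact ⟨pow_pos hr.1 2, pow_lt_one₀ hr.1.le hr.2 two_ne_zero⟩
    · intro hx
      exact ⟨√x, ⟨sqrt_pos.2 hx.1, by simpa using sqrt_lt_sqrt hx.1.le hx.2⟩, sq_sqrt hx.1.le⟩
  have hinj : InjOn (fun r : ℝ => r ^ 2) (Ioo 0 1) := fun r hr s hs h =>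
    (pow_left_inj₀ hr.1.le hs.1.le two_ne_zero).1 h
  have hsubst := lintegral_image_eq_lintegral_abs_deriv_mul measurableSet_Ioo
    (fun r _ => (hasDerivAt_pow 2 r).hasDerivWithinAt) hinj
    fun x => ENNReal.ofReal (x ^ n * (1 - x) ^ α)
  rw [himage, lintegral_pow_mul_one_sub_rpow hα] at hsubst
  rw [hsubst]
  refine setLIntegral_congr_fun measurableSet_Ioo fun r hr => ?_
  have hr0 : 0 ≤ 2 * r := by linarith [hr.1]
  simp only [Nat.cast_ofNat, Nat.add_one_sub_one, pow_one, abs_of_nonneg hr0,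
    ENNReal.ofReal_mul hr0]

end BetaIntegrals

section BergmanNorm

open Set Real

variable {E : Type*} [NormedAddCommGroup E]

/-- The squared norm of `F` in the (vector-valued) Bergman space `A²_α`, infinite when `F` does
not belong to it. -/
noncomputable def bergmanENormSq (α : ℝ) (F : ℂ → E) : ENNReal :=
  ENNReal.ofReal ((α + 1) / π) *
    ∫⁻ z in unitDisk, ENNReal.ofReal (‖F z‖ ^ 2 * (1 - ‖z‖ ^ 2) ^ α)

lemma bergmanENormSq_eq_one_of_bergmanNorm_eq_one {α : ℝ} (hα : -1 < α) {f : ℂ → ℂ}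
    (hf : MemBergman α f) (hnorm : bergmanNorm α f = 1) : bergmanENormSq α f = 1 := by
  have hα1 : 0 < α + 1 := by linarith
  have hnonneg : 0 ≤ᵐ[volume.restrict unitDisk] fun z => ‖f z‖ ^ 2 * (1 - ‖z‖ ^ 2) ^ α := by
    filter_upwards [ae_restrict_mem isOpen_unitDisk.measurableSet] with z hz
    exact mul_nonneg (sq_nonneg _) (rpow_nonneg (one_sub_norm_sq_pos hz).le _)
  rw [bergmanENormSq, ← ofReal_integral_eq_lintegral_ofReal hf.2 hnonneg,
    ← ENNReal.ofReal_mul (by positivity), ENNReal.ofReal_eq_one]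
  rwa [bergmanNorm, sqrt_eq_one] at hnorm

lemma continuousOn_one_sub_norm_sq_rpow (α : ℝ) :
    ContinuousOn (fun z : ℂ => (1 - ‖z‖ ^ 2) ^ α) unitDisk :=
  ContinuousOn.rpow_const (by fun_prop) fun _ hz => .inl (one_sub_norm_sq_pos hz).ne'

lemma setLIntegral_norm_sq_mul_one_sub_norm_sq_rpow_eq (α : ℝ) {F : ℂ → E}
    (hF : ContinuousOn F unitDisk) :
    ∫⁻ z in unitDisk, ENNReal.ofReal (‖F z‖ ^ 2 * (1 - ‖z‖ ^ 2) ^ α) =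
      ∫⁻ r in Ioo 0 1, ENNReal.ofReal
        (π * (2 * r * (1 - r ^ 2) ^ α * circleAverage (fun z => ‖F z‖ ^ 2) 0 r)) := by
  have hcont : ContinuousOn (fun p : ℝ × ℝ => circleMap 0 p.1 p.2) (Ioo 0 1 ×ˢ Ioo (-π) π) := by
    unfold circleMap; fun_prop
  have hmaps : MapsTo (fun p : ℝ × ℝ => circleMap 0 p.1 p.2) (Ioo 0 1 ×ˢ Ioo (-π) π) unitDisk :=
    fun p hp => mem_unitDisk.2 (by simpa [abs_of_pos hp.1.1] using hp.1.2)
  have hmeas : AEMeasurable (fun p : ℝ × ℝ => ENNReal.ofReal p.1 * ENNReal.ofReal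
      (‖F (circleMap 0 p.1 p.2)‖ ^ 2 * (1 - ‖circleMap 0 p.1 p.2‖ ^ 2) ^ α))
      (volume.restrict (Ioo 0 1 ×ˢ Ioo (-π) π)) :=
    (ENNReal.measurable_ofReal.comp measurable_fst).aemeasurable.mul <|
      ENNReal.measurable_ofReal.comp_aemeasurable <|
        (((hF.norm.pow 2).mul (continuousOn_one_sub_norm_sq_rpow α)).comp hcont hmaps).aemeasurable
          (measurableSet_Ioo.prod measurableSet_Ioo)
  rw [setLIntegral_unitDisk_eq_polar, Measure.volume_eq_prod, setLIntegral_prod _ hmeas]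
  refine setLIntegral_congr_fun measurableSet_Ioo fun r hr => ?_
  have hr0 : 0 ≤ r := hr.1.le
  have hw : 0 ≤ (1 - r ^ 2) ^ α := rpow_nonneg (by nlinarith [hr.1, hr.2]) _
  have hsphere : ContinuousOn (fun z => ‖F z‖ ^ 2) (Metric.sphere 0 |r|) :=
    (hF.norm.pow 2).mono (sphere_subset_unitDisk (by rw [abs_of_pos hr.1]; exact hr.2))
  simp only [norm_circleMap_zero, sq_abs, mul_comm (‖_‖ ^ 2), ENNReal.ofReal_mul hw]
  rw [lintegral_const_mul' _ _ ENNReal.ofReal_ne_top,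
    lintegral_const_mul' _ _ ENNReal.ofReal_ne_top,
    lintegral_circleMap_ofReal hsphere fun _ _ => sq_nonneg _, ← ENNReal.ofReal_mul hw,
    ← ENNReal.ofReal_mul hr0]
  congr 1
  ring
variable [InnerProductSpace ℂ E] [CompleteSpace E]

lemma ofReal_sum_taylorTermNormSq_le {α : ℝ} (hα : -1 < α) {F : ℂ → E}
    (hF : DifferentiableOn ℂ F unitDisk) (N : ℕ) :
    ENNReal.ofReal (∑ n ∈ Finset.range N, taylorTermNormSq (α + 2) F n) ≤ bergmanENormSq α F := by
  have hα1 : 0 < α + 1 := by linarith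
  have hterm : ∀ n, taylorTermNormSq (α + 2) F n = (α + 1) / π *
      (π * ‖taylorCoeff F n‖ ^ 2 * (1 / ((α + 1) * Ring.multichoose (α + 2) n))) := by
    intro n
    rw [taylorTermNormSq]
    field_simp
  have hcircle : ∀ r ∈ Ioo (0 : ℝ) 1,
      ∑ n ∈ Finset.range N, ENNReal.ofReal (π * ‖taylorCoeff F n‖ ^ 2) *
        ENNReal.ofReal (2 * r * ((r ^ 2) ^ n * (1 - r ^ 2) ^ α)) ≤ ENNReal.ofReal
          (π * (2 * r * (1 - r ^ 2) ^ α * circleAverage (fun z => ‖F z‖ ^ 2) 0 r)) := by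
    intro r hr
    have hr0 := hr.1
    have hw : 0 ≤ (1 - r ^ 2) ^ α := rpow_nonneg (by nlinarith [hr.2]) _
    have hbessel := sum_norm_taylorCoeff_sq_mul_pow_le_circleAverage N hF
      (by rw [abs_of_pos hr0]; exact hr.2)
    have hsum : ∑ n ∈ Finset.range N, π * ‖taylorCoeff F n‖ ^ 2 *
        (2 * r * ((r ^ 2) ^ n * (1 - r ^ 2) ^ α)) =
          π * (2 * r * (1 - r ^ 2) ^ α *
            ∑ n ∈ Finset.range N, ‖taylorCoeff F n‖ ^ 2 * (r ^ 2) ^ n) := by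
      simp only [Finset.mul_sum]
      exact Finset.sum_congr rfl fun n _ => by ring
    simp only [← ENNReal.ofReal_mul (show 0 ≤ π * ‖taylorCoeff F _‖ ^ 2 by positivity)]
    rw [← ENNReal.ofReal_sum_of_nonneg fun n _ => by positivity, hsum]
    gcongr
  calc ENNReal.ofReal (∑ n ∈ Finset.range N, taylorTermNormSq (α + 2) F n)
      = ENNReal.ofReal ((α + 1) / π) * ∑ n ∈ Finset.range N,
          ∫⁻ r in Ioo (0 : ℝ) 1, ENNReal.ofReal (π * ‖taylorCoeff F n‖ ^ 2) *
            ENNReal.ofReal (2 * r * ((r ^ 2) ^ n * (1 - r ^ 2) ^ α)) := by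
        rw [ENNReal.ofReal_sum_of_nonneg fun n _ => taylorTermNormSq_nonneg (by linarith) F n,
          Finset.mul_sum]
        refine Finset.sum_congr rfl fun n _ => ?_
        rw [lintegral_const_mul' _ _ ENNReal.ofReal_ne_top, lintegral_pow_mul_one_sub_sq_rpow hα,
          ← ENNReal.ofReal_mul (by positivity), ← ENNReal.ofReal_mul (by positivity), hterm]
    _ ≤ bergmanENormSq α F := by
        rw [bergmanENormSq, setLIntegral_norm_sq_mul_one_sub_norm_sq_rpow_eq α hF.continuousOn,
          ← lintegral_finsetSum _ fun n _ => by fun_prop]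
        gcongr _ * ?_
        exact setLIntegral_mono' measurableSet_Ioo hcircle

lemma summable_taylorTermNormSq {α : ℝ} (hα : -1 < α) {F : ℂ → E}
    (hF : DifferentiableOn ℂ F unitDisk) (hnorm : bergmanENormSq α F ≤ 1) :
    Summable (taylorTermNormSq (α + 2) F) :=
  summable_of_sum_range_le (c := 1) (taylorTermNormSq_nonneg (by linarith) F) fun N =>
    ENNReal.ofReal_le_one.1 ((ofReal_sum_taylorTermNormSq_le hα hF N).trans hnorm)

lemma tsum_taylorTermNormSq_le_one {α : ℝ} (hα : -1 < α) {F : ℂ → E}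
    (hF : DifferentiableOn ℂ F unitDisk) (hnorm : bergmanENormSq α F ≤ 1) :
    ∑' n, taylorTermNormSq (α + 2) F n ≤ 1 :=
  Real.tsum_le_of_sum_range_le (taylorTermNormSq_nonneg (by linarith) F) fun N =>
    ENNReal.ofReal_le_one.1 ((ofReal_sum_taylorTermNormSq_le hα hF N).trans hnorm)

end BergmanNorm

section HyperbolicMeasure

open Set Real

lemma hyperbolicMeasure_apply {S : Set ℂ} (hS : MeasurableSet S) :
    hyperbolicMeasure S = ∫⁻ z in S ∩ unitDisk, ENNReal.ofReal (1 / (1 - ‖z‖ ^ 2) ^ 2) := by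
  rw [hyperbolicMeasure, withDensity_apply _ hS, Measure.restrict_restrict hS]

lemma setLIntegral_radial_hyperbolicDensity {R : ℝ} (hR : R ∈ Ico 0 1) :
    ∫⁻ r in Ioc 0 R, ENNReal.ofReal (r * (1 / (1 - r ^ 2) ^ 2)) =
      ENNReal.ofReal (((1 - R ^ 2)⁻¹ - 1) / 2) := by
  have hpos : ∀ r ∈ Icc 0 R, 0 < 1 - r ^ 2 := fun r hr => by nlinarith [hr.1, hr.2, hR.2]
  have hcont : ContinuousOn (fun r : ℝ => r * (1 / (1 - r ^ 2) ^ 2)) (Icc 0 R) :=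
    continuousOn_id.mul (continuousOn_const.div (by fun_prop) fun r hr =>
      (pow_pos (hpos r hr) 2).ne')
  have hprim : ∀ r ∈ uIcc 0 R, HasDerivAt (fun r : ℝ => (1 - r ^ 2)⁻¹ / 2)
      (r * (1 / (1 - r ^ 2) ^ 2)) r := by
    intro r hr
    rw [uIcc_of_le hR.1] at hr
    refine ((((hasDerivAt_pow 2 r).const_sub 1).inv (hpos r hr).ne').div_const 2).congr_deriv ?_
    push_cast
    ring
  rw [← ofReal_integral_eq_lintegral_ofReal (hcont.integrableOn_Icc.mono_set Ioc_subset_Icc_self),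
    ← intervalIntegral.integral_of_le hR.1,
    intervalIntegral.integral_eq_sub_of_hasDerivAt hprim
      (hcont.intervalIntegrable_of_Icc hR.1)]
  · congr 1
    ring
  · filter_upwards [ae_restrict_mem measurableSet_Ioc] with r hr
    exact mul_nonneg hr.1.le (by positivity)

lemma setLIntegral_radial_hyperbolicDensity_le {A : Set ℝ} {W : ℝ} (hW : 1 ≤ W)
    (hA : ∀ r ∈ A, 0 < r ∧ r < 1 ∧ (1 - r ^ 2)⁻¹ ≤ W) :
    ∫⁻ r in A, ENNReal.ofReal (r * (1 / (1 - r ^ 2) ^ 2)) ≤ ENNReal.ofReal ((W - 1) / 2) := by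
  have hW0 : 0 < W⁻¹ := inv_pos.2 (by linarith)
  have hsq : √(1 - W⁻¹) ^ 2 = 1 - W⁻¹ := sq_sqrt (sub_nonneg.2 (inv_le_one_of_one_le₀ hW))
  have hsub : A ⊆ Ioc 0 √(1 - W⁻¹) := by
    intro r hr
    obtain ⟨hr0, hr1, hrW⟩ := hA r hr
    have := inv_anti₀ (inv_pos.2 (by nlinarith)) hrW
    rw [inv_inv] at this
    exact ⟨hr0, le_sqrt_of_sq_le (by linarith)⟩
  have hR : √(1 - W⁻¹) ∈ Ico (0 : ℝ) 1 :=
    ⟨sqrt_nonneg _, by rw [sqrt_lt' one_pos]; linarith⟩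
  refine (lintegral_mono_set hsub).trans_eq ?_
  rw [setLIntegral_radial_hyperbolicDensity hR, hsq, sub_sub_cancel, inv_inv]

lemma hyperbolicMeasure_le_of_polar {S : Set ℂ} (hS : MeasurableSet S) {W : ℝ → ℝ}
    (hW : ∀ θ, 1 ≤ W θ)
    (hSW : ∀ r ∈ Ioo (0 : ℝ) 1, ∀ θ, circleMap 0 r θ ∈ S → (1 - r ^ 2)⁻¹ ≤ W θ) :
    hyperbolicMeasure S ≤ ∫⁻ θ in Ioo (-π) π, ENNReal.ofReal ((W θ - 1) / 2) := by
  rw [hyperbolicMeasure_apply hS, ← setLIntegral_indicator hS, setLIntegral_unitDisk_eq_polar,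
    Measure.volume_eq_prod, ← Measure.prod_restrict, ← lintegral_prod_swap]
  refine (lintegral_prod_le _).trans (lintegral_mono fun θ => ?_)
  have hA : MeasurableSet (Ioo 0 1 ∩ (fun r => circleMap 0 r θ) ⁻¹' S) :=
    measurableSet_Ioo.inter (hS.preimage (by unfold circleMap; fun_prop))
  refine le_trans (le_of_eq ?_) (setLIntegral_radial_hyperbolicDensity_le (hW θ)
    (A := Ioo 0 1 ∩ (fun r => circleMap 0 r θ) ⁻¹' S)
    fun r hr => ⟨hr.1.1, hr.1.2, hSW r hr.1 θ hr.2⟩)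
  rw [← lintegral_indicator measurableSet_Ioo, ← lintegral_indicator hA]
  congr 1
  ext r
  by_cases hr : r ∈ Ioo (0 : ℝ) 1
  · by_cases hrS : circleMap 0 r θ ∈ S <;>
      simp [hr, hrS, indicator, ENNReal.ofReal_mul hr.1.le]
  · simp [hr]

/-- By the mean value property only the value of `g` at the centre matters. -/
lemma hyperbolicMeasure_le_of_polar_re {S : Set ℂ} (hS : MeasurableSet S) {g : ℂ → ℂ}
    (hg : DifferentiableOn ℂ g unitDisk) {r₀ : ℝ} (hr₀ : r₀ ∈ Ico 0 1)
    (hg0 : ∀ θ, 0 ≤ (g (circleMap 0 r₀ θ)).re)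
    (hSg : ∀ r ∈ Ioo (0 : ℝ) 1, ∀ θ, circleMap 0 r θ ∈ S →
      (1 - r ^ 2)⁻¹ ≤ 1 + 2 * (g (circleMap 0 r₀ θ)).re) :
    hyperbolicMeasure S ≤ ENNReal.ofReal (2 * π * (g 0).re) := by
  have hr₀' : |r₀| < 1 := by rw [abs_of_nonneg hr₀.1]; exact hr₀.2
  have hcont : ContinuousOn (fun z => (g z).re) (Metric.sphere 0 |r₀|) :=
    Complex.continuous_re.comp_continuousOn (hg.continuousOn.mono (sphere_subset_unitDisk hr₀'))
  have hnonneg : ∀ z ∈ Metric.sphere (0 : ℂ) |r₀|, 0 ≤ (g z).re := by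
    rw [← image_circleMap_Ioc 0 r₀]
    rintro _ ⟨θ, -, rfl⟩
    exact hg0 θ
  refine (hyperbolicMeasure_le_of_polar hS (fun θ => by linarith [hg0 θ]) hSg).trans_eq ?_
  simp only [add_sub_cancel_left, mul_div_cancel_left₀ _ (two_ne_zero' ℝ)]
  rw [lintegral_circleMap_ofReal hcont hnonneg, circleAverage_re_eq_re hg hr₀']

end HyperbolicMeasure

section PerturbedLevelSets

open Set Real

lemma rpow_neg_rpow_one_div {x β : ℝ} (hx : 0 ≤ x) (hβ : β ≠ 0) : (x ^ (-β)) ^ (1 / β) = x⁻¹ := by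
  rw [← rpow_mul hx, neg_mul, mul_one_div_cancel hβ, rpow_neg_one]

lemma exists_one_sub_sq_rpow_neg_eq {β M : ℝ} (hβ : 0 < β) (hM : 1 ≤ M) :
    ∃ r ∈ Ico (0 : ℝ) 1, (1 - r ^ 2) ^ (-β) = M := by
  have hM0 : 0 < M := by linarith
  have hpos : 0 < M ^ (-(1 / β)) := rpow_pos_of_pos hM0 _
  have hle : M ^ (-(1 / β)) ≤ 1 := rpow_le_one_of_one_le_of_nonpos hM (by simp [hβ.le])
  refine ⟨√(1 - M ^ (-(1 / β))), ⟨sqrt_nonneg _, ?_⟩, ?_⟩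
  · rw [sqrt_lt' one_pos]
    linarith
  · rw [sq_sqrt (by linarith), sub_sub_cancel, ← rpow_mul hM0.le, neg_mul_neg,
      one_div_mul_cancel hβ.ne', rpow_one]

lemma rpow_one_div_le_of_le_mul_one_add {β M x y : ℝ} (hβ : 1 ≤ β) (hM : 0 ≤ M) (hx : -1 ≤ x)
    (hy : 0 ≤ y) (hle : y ≤ M * (1 + x)) : y ^ (1 / β) ≤ M ^ (1 / β) * (1 + 1 / β * x) := by
  have hβ0 : 0 < β := by linarith
  calc y ^ (1 / β) ≤ (M * (1 + x)) ^ (1 / β) := by gcongr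
    _ = M ^ (1 / β) * (1 + x) ^ (1 / β) := mul_rpow hM (by linarith)
    _ ≤ M ^ (1 / β) * (1 + 1 / β * x) := by
      gcongr
      exact rpow_one_add_le_one_add_mul_self hx (by positivity) ((div_le_one hβ0).2 hβ)

lemma rpow_one_div_mul_sub_one_le {β M : ℝ} (hβ : 1 ≤ β) (hM : 0 < M) :
    M ^ (1 / β) * ((M - 1) / β) ≤ M * (M ^ (1 / β) - 1) := by
  have h := rpow_one_div_le_of_le_mul_one_add (M := M) (x := M⁻¹ - 1) hβ hM.le
    (by linarith [inv_pos.2 hM]) zero_le_one (by rw [add_sub_cancel, mul_inv_cancel₀ hM.ne'])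
  rw [one_rpow] at h
  calc M ^ (1 / β) * ((M - 1) / β)
      = M * (M ^ (1 / β) - M ^ (1 / β) * (1 + 1 / β * (M⁻¹ - 1))) := by field_simp; ring
    _ ≤ M * (M ^ (1 / β) - 1) := by gcongr

lemma rpow_one_div_mul_one_add_sub_one_le {A β M : ℝ} (hA : 0 ≤ A) (hβ : 1 ≤ β) (hM : 0 < M) :
    M ^ (1 / β) * (1 + 1 / β * (A * M * (M - 1))) - 1 ≤ (1 + A * M ^ 2) * (M ^ (1 / β) - 1) :=
  calc M ^ (1 / β) * (1 + 1 / β * (A * M * (M - 1))) - 1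
      = M ^ (1 / β) - 1 + A * M * (M ^ (1 / β) * ((M - 1) / β)) := by ring
    _ ≤ M ^ (1 / β) - 1 + A * M * (M * (M ^ (1 / β) - 1)) := by
      gcongr _ + _ * ?_
      exact rpow_one_div_mul_sub_one_le hβ hM
    _ = (1 + A * M ^ 2) * (M ^ (1 / β) - 1) := by ring

/-- Here `y` and `M` are the values of `(1 - r²)^(-β)` on the boundaries of a perturbed and of an
unperturbed superlevel set, and `h`, `h₀` those of the first-order term of the perturbation, whose
variation along a ray is controlled by that of `(1 - r²)^(-β)`. Replacing `h` by `h₀` costs only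
`O(δ²)`. -/
lemma le_mul_of_lt_perturbation {M δ y h h₀ : ℝ} (hM : 1 ≤ M) (hδ : 0 ≤ δ)
    (hδM : 6 * (δ * M) ≤ 1) (hy : 1 ≤ y) (hh : |h| ≤ 2 * δ * (y - 1)) (hh₀ : |h₀| ≤ 2 * δ * (M - 1))
    (hd : |h - h₀| ≤ 2 * δ * |y - M|) (hlev : y < M * (1 + h + δ ^ 2 * (y - 1))) :
    y ≤ M * (1 + h₀ + 14 * δ ^ 2 * M * (M - 1)) := by
  have hM0 : 0 < M := by linarith
  have hδ1 : δ ^ 2 ≤ δ := by nlinarith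
  have hM1 : 0 ≤ δ * (M - 1) := mul_nonneg hδ (by linarith)
  have hupper : y - M ≤ 3 * (δ * M) * (y - 1) := by
    have : y < M * (1 + 3 * δ * (y - 1)) :=
      hlev.trans_le <| mul_le_mul_of_nonneg_left (by nlinarith [(abs_le.1 hh).2]) hM0.le
    linarith
  have hy2 : y - 1 ≤ 2 * (M - 1) := by nlinarith
  have hyM : y - M ≤ 6 * δ * M * (M - 1) := by
    have : 3 * (δ * M) * (y - 1) ≤ 3 * (δ * M) * (2 * (M - 1)) := by gcongr
    linarith
  by_cases hfar : M - y ≤ 6 * δ * M * (M - 1)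
  · have hdist : |y - M| ≤ 6 * δ * M * (M - 1) := abs_le.2 ⟨by linarith, hyM⟩
    have hfirst : h ≤ h₀ + 12 * δ ^ 2 * M * (M - 1) := by
      have : 2 * δ * |y - M| ≤ 2 * δ * (6 * δ * M * (M - 1)) := by gcongr
      linarith [(abs_le.1 hd).2]
    have hsecond : δ ^ 2 * (y - 1) ≤ 2 * δ ^ 2 * M * (M - 1) := by
      have : δ ^ 2 * (y - 1) ≤ δ ^ 2 * (2 * (M - 1)) := by gcongr
      nlinarith [mul_nonneg (mul_nonneg (sq_nonneg δ) (sub_nonneg.2 hM)) (sub_nonneg.2 hM)]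
    exact hlev.le.trans <| mul_le_mul_of_nonneg_left (by linarith) hM0.le
  · calc y ≤ M * (1 - 6 * (δ * (M - 1))) := by linarith
      _ ≤ M * (1 + h₀ + 14 * δ ^ 2 * M * (M - 1)) := by
        have : 0 ≤ 14 * δ ^ 2 * M * (M - 1) := mul_nonneg (by positivity) (by linarith)
        gcongr
        linarith [(abs_le.1 hh₀).1]

lemma hasDerivAt_one_sub_sq_rpow_neg (β : ℝ) {r : ℝ} (hr : r ^ 2 < 1) :
    HasDerivAt (fun r : ℝ => (1 - r ^ 2) ^ (-β)) (2 * β * r * (1 - r ^ 2) ^ (-(β + 1))) r := by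
  convert ((hasDerivAt_pow 2 r).const_sub 1).rpow_const (p := -β)
    (.inl (sub_pos.2 hr).ne') using 1
  rw [show -(β + 1) = -β - 1 by ring]
  push_cast
  ring

variable {E : Type*} [NormedAddCommGroup E] [NormedSpace ℂ E] {h : ℂ → E} {β δ M : ℝ}

lemma norm_circleMap_sub_le_of_norm_deriv_le (hh : DifferentiableOn ℂ h unitDisk)
    (hderiv : ∀ z ∈ unitDisk, ‖deriv h z‖ ≤ δ * (2 * β * ‖z‖ * (1 - ‖z‖ ^ 2) ^ (-(β + 1))))
    {r R : ℝ} (hr : 0 ≤ r) (hrR : r ≤ R) (hR : R < 1) (θ : ℝ) :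
    ‖h (circleMap 0 R θ) - h (circleMap 0 r θ)‖ ≤
      δ * ((1 - R ^ 2) ^ (-β) - (1 - r ^ 2) ^ (-β)) := by
  have hx0 : ∀ x ∈ Icc r R, 0 ≤ x := fun x hx => hr.trans hx.1
  have hmem : ∀ x ∈ Icc r R, circleMap 0 x θ ∈ unitDisk := fun x hx =>
    mem_unitDisk.2 (by simpa [abs_of_nonneg (hx0 x hx)] using hx.2.trans_lt hR)
  have hray : ∀ x ∈ Icc r R, HasDerivAt (fun x => h (circleMap 0 x θ) - h (circleMap 0 r θ))
      (Complex.exp (θ * Complex.I) • deriv h (circleMap 0 x θ)) x := by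
    intro x hx
    have hline : HasDerivAt (fun x : ℝ => circleMap 0 x θ) (Complex.exp (θ * Complex.I)) x := by
      simpa [circleMap] using (Complex.ofRealCLM.hasDerivAt (x := x)).mul_const _
    exact ((hh.differentiableAt (isOpen_unitDisk.mem_nhds (hmem x hx))).hasDerivAt.scomp x
      hline).sub_const _
  have hbound : ∀ x ∈ Icc r R, HasDerivAt
      (fun x : ℝ => δ * ((1 - x ^ 2) ^ (-β) - (1 - r ^ 2) ^ (-β)))
      (δ * (2 * β * x * (1 - x ^ 2) ^ (-(β + 1)))) x := fun x hx =>
    ((hasDerivAt_one_sub_sq_rpow_neg β (by nlinarith [hx0 x hx, hx.2])).sub_const _).const_mul δ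
  refine image_norm_le_of_norm_deriv_right_le_deriv_boundary'
    (fun x hx => (hray x hx).continuousAt.continuousWithinAt)
    (fun x hx => (hray x (Ico_subset_Icc_self hx)).hasDerivWithinAt) (by simp)
    (fun x hx => (hbound x hx).continuousAt.continuousWithinAt)
    (fun x hx => (hbound x (Ico_subset_Icc_self hx)).hasDerivWithinAt)
    (fun x hx => ?_) (right_mem_Icc.2 hrR)
  have hx := Ico_subset_Icc_self hx
  simpa [norm_smul, Complex.norm_exp_ofReal_mul_I, abs_of_nonneg (hx0 x hx)]
    using hderiv _ (hmem x hx)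

lemma norm_circleMap_sub_le_abs_of_norm_deriv_le (hδ : 0 ≤ δ)
    (hh : DifferentiableOn ℂ h unitDisk)
    (hderiv : ∀ z ∈ unitDisk, ‖deriv h z‖ ≤ δ * (2 * β * ‖z‖ * (1 - ‖z‖ ^ 2) ^ (-(β + 1))))
    {r s : ℝ} (hr : r ∈ Ico 0 1) (hs : s ∈ Ico 0 1) (θ : ℝ) :
    ‖h (circleMap 0 r θ) - h (circleMap 0 s θ)‖ ≤
      δ * |(1 - r ^ 2) ^ (-β) - (1 - s ^ 2) ^ (-β)| := by
  wlog hsr : s ≤ r generalizing r s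
  · rw [norm_sub_rev, abs_sub_comm]
    exact this hs hr (le_of_not_ge hsr)
  · refine (norm_circleMap_sub_le_of_norm_deriv_le hh hderiv hs.1 hsr hr.2 θ).trans ?_
    gcongr
    exact le_abs_self _

variable {h : ℂ → ℂ}

lemma rpow_neg_le_of_lt_perturbation (hβ : 0 ≤ β) (hδ : 0 ≤ δ) (hM : 1 ≤ M)
    (hδM : 6 * (δ * M) ≤ 1) (hh : DifferentiableOn ℂ h unitDisk) (h0 : h 0 = 0)
    (hderiv : ∀ z ∈ unitDisk, ‖deriv h z‖ ≤ δ * (2 * β * ‖z‖ * (1 - ‖z‖ ^ 2) ^ (-(β + 1))))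
    {r r₀ : ℝ} (hr : r ∈ Ico 0 1) (hr₀ : r₀ ∈ Ico 0 1) (hM₀ : (1 - r₀ ^ 2) ^ (-β) = M) {θ : ℝ}
    (hlev : (1 - r ^ 2) ^ (-β) < M * (1 + 2 * (h (circleMap 0 r θ)).re +
      δ ^ 2 * ((1 - r ^ 2) ^ (-β) - 1))) :
    (1 - r ^ 2) ^ (-β) ≤
      M * (1 + 2 * (h (circleMap 0 r₀ θ)).re + 14 * δ ^ 2 * M * (M - 1)) := by
  have hone_le : ∀ s ∈ Ico (0 : ℝ) 1, 1 ≤ (1 - s ^ 2) ^ (-β) := fun s hs =>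
    one_le_rpow_of_pos_of_le_one_of_nonpos (by nlinarith [hs.1, hs.2]) (by nlinarith) (by linarith)
  have hlip : ∀ s ∈ Ico (0 : ℝ) 1, ∀ s' ∈ Ico (0 : ℝ) 1,
      |2 * (h (circleMap 0 s θ)).re - 2 * (h (circleMap 0 s' θ)).re| ≤
        2 * δ * |(1 - s ^ 2) ^ (-β) - (1 - s' ^ 2) ^ (-β)| := by
    intro s hs s' hs'
    rw [← mul_sub, abs_mul, abs_two, mul_assoc, ← Complex.sub_re]
    gcongr
    exact (Complex.abs_re_le_norm _).trans
      (norm_circleMap_sub_le_abs_of_norm_deriv_le hδ hh hderiv hs hs' θ)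
  have hbound : ∀ s ∈ Ico (0 : ℝ) 1,
      |2 * (h (circleMap 0 s θ)).re| ≤ 2 * δ * ((1 - s ^ 2) ^ (-β) - 1) := by
    intro s hs
    simpa [h0, abs_of_nonneg (sub_nonneg.2 (hone_le s hs))] using
      hlip s hs 0 (left_mem_Ico.2 one_pos)
  have hbound₀ := hbound r₀ hr₀
  have hlip₀ := hlip r hr r₀ hr₀
  rw [hM₀] at hbound₀ hlip₀
  exact le_mul_of_lt_perturbation hM hδ hδM (hone_le r hr) (hbound r hr) hbound₀ hlip₀ hlev

lemma one_le_mul_one_add_re_circleMap (hM : 1 ≤ M) (hδM : 6 * (δ * M) ≤ 1)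
    (hh : DifferentiableOn ℂ h unitDisk) (h0 : h 0 = 0)
    (hderiv : ∀ z ∈ unitDisk, ‖deriv h z‖ ≤ δ * (2 * β * ‖z‖ * (1 - ‖z‖ ^ 2) ^ (-(β + 1))))
    {r : ℝ} (hr : r ∈ Ico 0 1) (hrM : (1 - r ^ 2) ^ (-β) = M) (θ : ℝ) :
    1 ≤ M * (1 + 2 * (h (circleMap 0 r θ)).re) := by
  have hre : |(h (circleMap 0 r θ)).re| ≤ δ * (M - 1) := (Complex.abs_re_le_norm _).trans <| by
    simpa [h0, hrM] using norm_circleMap_sub_le_of_norm_deriv_le hh hderiv le_rfl hr.1 hr.2 θ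
  nlinarith [(abs_le.1 hre).1]

theorem hyperbolicMeasure_perturbed_level_le (hβ : 1 ≤ β) (hδ : 0 ≤ δ) (hM : 1 ≤ M)
    (hδM : 6 * (δ * M) ≤ 1) (hh : DifferentiableOn ℂ h unitDisk) (h0 : h 0 = 0)
    (hderiv : ∀ z ∈ unitDisk, ‖deriv h z‖ ≤ δ * (2 * β * ‖z‖ * (1 - ‖z‖ ^ 2) ^ (-(β + 1))))
    {S : Set ℂ} (hS : MeasurableSet S)
    (hlev : ∀ z ∈ S, (1 - ‖z‖ ^ 2) ^ (-β) < M * (1 + 2 * (h z).re +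
      δ ^ 2 * ((1 - ‖z‖ ^ 2) ^ (-β) - 1))) :
    hyperbolicMeasure S ≤
      ENNReal.ofReal (π * (1 + 14 * δ ^ 2 * M ^ 2) * (M ^ (1 / β) - 1)) := by
  have hβ0 : 0 < β := by linarith
  have hM0 : 0 < M := by linarith
  obtain ⟨r₀, hr₀, hM₀⟩ := exists_one_sub_sq_rpow_neg_eq hβ0 hM
  let K := 14 * δ ^ 2 * M * (M - 1)
  let g : ℂ → ℂ := fun z =>
    (((M ^ (1 / β) * (1 + 1 / β * K) - 1) / 2 : ℝ) : ℂ) + ((M ^ (1 / β) / β : ℝ) : ℂ) * h z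
  have hK : 0 ≤ K := mul_nonneg (by positivity) (by linarith)
  have hg_re : ∀ z, 1 + 2 * (g z).re = M ^ (1 / β) * (1 + 1 / β * (2 * (h z).re + K)) := by
    intro z
    simp only [g, Complex.add_re, Complex.ofReal_re, Complex.re_ofReal_mul]
    ring
  have hx : ∀ θ, 1 ≤ M * (1 + (2 * (h (circleMap 0 r₀ θ)).re + K)) := fun θ => by
    linarith [one_le_mul_one_add_re_circleMap hM hδM hh h0 hderiv hr₀ hM₀ θ, mul_nonneg hM0.le hK]
  have hg_bound : ∀ y θ, 0 ≤ y → y ≤ M * (1 + (2 * (h (circleMap 0 r₀ θ)).re + K)) →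
      y ^ (1 / β) ≤ 1 + 2 * (g (circleMap 0 r₀ θ)).re := by
    intro y θ hy hyM
    rw [hg_re]
    exact rpow_one_div_le_of_le_mul_one_add hβ hM0.le (by nlinarith [hx θ]) hy hyM
  refine (hyperbolicMeasure_le_of_polar_re hS ((hh.const_mul _).const_add _) (g := g) hr₀
    (fun θ => ?_) fun r hr θ hz => ?_).trans (ENNReal.ofReal_le_ofReal ?_)
  · have := hg_bound 1 θ zero_le_one (hx θ)
    rw [one_rpow] at this
    linarith
  · have hpos : 0 < 1 - r ^ 2 := by nlinarith [hr.1, hr.2]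
    have hlev_r := hlev _ hz
    rw [norm_circleMap_zero, sq_abs] at hlev_r
    rw [← rpow_neg_rpow_one_div hpos.le hβ0.ne']
    refine hg_bound _ θ (rpow_nonneg hpos.le _) ?_
    rw [← add_assoc]
    exact rpow_neg_le_of_lt_perturbation hβ0.le hδ hM hδM hh h0 hderiv (Ioo_subset_Ico_self hr) hr₀
      hM₀ hlev_r
  · calc 2 * π * (g 0).re = π * (1 + 2 * (g 0).re - 1) := by ring
      _ = π * (M ^ (1 / β) * (1 + 1 / β * K) - 1) := by
          rw [hg_re, h0, Complex.zero_re, mul_zero, zero_add]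
      _ ≤ π * ((1 + 14 * δ ^ 2 * M ^ 2) * (M ^ (1 / β) - 1)) := by
          gcongr
          exact rpow_one_div_mul_one_add_sub_one_le (by positivity) hβ hM0
      _ = π * (1 + 14 * δ ^ 2 * M ^ 2) * (M ^ (1 / β) - 1) := by ring

end PerturbedLevelSets

section VectorBergmanDensity

open Set Real

variable {E : Type*} [NormedAddCommGroup E]

/-- The density `|F|² (1 - |z|²)^(α+2)` of a vector-valued function; for complex-valued functions
this is `bergmanDensity`. -/
noncomputable def vectorBergmanDensity (α : ℝ) (F : ℂ → E) (z : ℂ) : ℝ :=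
  ‖F z‖ ^ 2 * (1 - ‖z‖ ^ 2) ^ (α + 2)

lemma vectorBergmanDensity_zero (α : ℝ) (F : ℂ → E) : vectorBergmanDensity α F 0 = ‖F 0‖ ^ 2 := by
  simp [vectorBergmanDensity]

lemma lt_vectorBergmanDensity_iff {α t : ℝ} {F : ℂ → E} {z : ℂ} (hz : z ∈ unitDisk) :
    t < vectorBergmanDensity α F z ↔ t * (1 - ‖z‖ ^ 2) ^ (-(α + 2)) < ‖F z‖ ^ 2 := by
  rw [vectorBergmanDensity, rpow_neg (one_sub_norm_sq_pos hz).le, ← div_eq_mul_inv,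
    div_lt_iff₀ (rpow_pos_of_pos (one_sub_norm_sq_pos hz) _)]

lemma isOpen_superlevel_vectorBergmanDensity (α t : ℝ) {F : ℂ → E} (hF : ContinuousOn F unitDisk) :
    IsOpen {z | z ∈ unitDisk ∧ t < vectorBergmanDensity α F z} :=
  ((hF.norm.pow 2).mul (continuousOn_one_sub_norm_sq_rpow (α + 2))).isOpen_inter_preimage
    isOpen_unitDisk isOpen_Ioi

variable [InnerProductSpace ℂ E] [CompleteSpace E] {α : ℝ} {F : ℂ → E}

lemma tsum_taylorTermNormSq_succ_le_one_sub (hα : -1 < α) (hF : DifferentiableOn ℂ F unitDisk)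
    (hnorm : bergmanENormSq α F ≤ 1) :
    ∑' n, taylorTermNormSq (α + 2) F (n + 1) ≤ 1 - ‖F 0‖ ^ 2 := by
  have h := (summable_taylorTermNormSq hα hF hnorm).tsum_eq_zero_add
  rw [taylorTermNormSq_zero] at h
  linarith [tsum_taylorTermNormSq_le_one hα hF hnorm]

lemma norm_sq_zero_le_one (hα : -1 < α) (hF : DifferentiableOn ℂ F unitDisk)
    (hnorm : bergmanENormSq α F ≤ 1) : ‖F 0‖ ^ 2 ≤ 1 :=
  sub_nonneg.1 <| (tsum_nonneg fun _ => taylorTermNormSq_nonneg (by linarith) F _).trans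
    (tsum_taylorTermNormSq_succ_le_one_sub hα hF hnorm)

lemma tsum_taylorTermNormSq_add_two_le_one_sub (hα : -1 < α) (hF : DifferentiableOn ℂ F unitDisk)
    (hnorm : bergmanENormSq α F ≤ 1) :
    ∑' n, taylorTermNormSq (α + 2) F (n + 2) ≤ 1 - ‖F 0‖ ^ 2 := by
  have h := ((summable_nat_add_iff 1).2 (summable_taylorTermNormSq hα hF hnorm)).tsum_eq_zero_add
  linarith [tsum_taylorTermNormSq_succ_le_one_sub hα hF hnorm,
    taylorTermNormSq_nonneg (show 0 < α + 2 by linarith) F (0 + 1)]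

lemma norm_sq_lt_of_lt_vectorBergmanDensity (hα : -1 < α) (hF : DifferentiableOn ℂ F unitDisk)
    (hnorm : bergmanENormSq α F ≤ 1) {t : ℝ} {z : ℂ} (hz : z ∈ unitDisk)
    (ht : t < vectorBergmanDensity α F z) :
    t * (1 - ‖z‖ ^ 2) ^ (-(α + 2)) < ‖F 0‖ ^ 2 + 2 * (inner ℂ (F 0) (F z - F 0)).re +
      (1 - ‖F 0‖ ^ 2) * ((1 - ‖z‖ ^ 2) ^ (-(α + 2)) - 1) := by
  have hpos := one_sub_norm_sq_pos hz
  have hone : 1 ≤ (1 - ‖z‖ ^ 2) ^ (-(α + 2)) :=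
    one_le_rpow_of_pos_of_le_one_of_nonpos hpos (by linarith [sq_nonneg ‖z‖]) (by linarith)
  calc t * (1 - ‖z‖ ^ 2) ^ (-(α + 2)) < ‖F z‖ ^ 2 := (lt_vectorBergmanDensity_iff hz).1 ht
    _ = ‖F 0‖ ^ 2 + 2 * (inner ℂ (F 0) (F z - F 0)).re + ‖F z - F 0‖ ^ 2 :=
      norm_sq_eq_norm_sq_add_re_inner_add _ _
    _ ≤ _ := by
      gcongr
      refine (norm_sub_sq_le_tsum_taylorTermNormSq_mul (by linarith) hF
        (summable_taylorTermNormSq hα hF hnorm) hz).trans ?_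
      gcongr
      exact tsum_taylorTermNormSq_succ_le_one_sub hα hF hnorm

lemma norm_deriv_inner_sub_le (hα : -1 < α) (hF : DifferentiableOn ℂ F unitDisk)
    (hnorm : bergmanENormSq α F ≤ 1) (hcrit : inner ℂ (F 0) (deriv F 0) = 0) {z : ℂ}
    (hz : z ∈ unitDisk) :
    ‖deriv (fun z => inner ℂ (F 0) (F z - F 0)) z‖ ≤ ‖F 0‖ * √(1 - ‖F 0‖ ^ 2) *
      (2 * (α + 2) * ‖z‖ * (1 - ‖z‖ ^ 2) ^ (-(α + 2 + 1))) := by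
  have hderiv : HasDerivAt (fun z => inner ℂ (F 0) (F z - F 0)) (inner ℂ (F 0) (deriv F z)) z :=
    (innerSL ℂ (F 0)).hasFDerivAt.comp_hasDerivAt z
      ((hF.differentiableAt (isOpen_unitDisk.mem_nhds hz)).hasDerivAt.sub_const _)
  have hsub : inner ℂ (F 0) (deriv F z) = inner ℂ (F 0) (deriv F z - deriv F 0) := by
    rw [inner_sub_right, hcrit, sub_zero]
  have hpos := one_sub_norm_sq_pos hz
  rw [hderiv.deriv, hsub, mul_assoc]
  refine (norm_inner_le_norm _ _).trans ?_
  gcongr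
  refine (norm_deriv_sub_le_sqrt_tsum_mul (β := α + 2) (by linarith) hF
    (summable_taylorTermNormSq hα hF hnorm) hz).trans ?_
  have : 0 ≤ α + 2 := by linarith
  gcongr
  exact tsum_taylorTermNormSq_add_two_le_one_sub hα hF hnorm

lemma mul_sqrt_div_sq {a : ℝ} (ha : 0 < a) (b : ℝ) : a * √b / a ^ 2 = √(b / a ^ 2) := by
  rw [sqrt_div' _ (sq_nonneg a), sqrt_sq ha.le]
  field_simp

theorem superlevelMeasure_le_of_isMaxOn_zero (hα : -1 < α) (hF : DifferentiableOn ℂ F unitDisk)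
    (hnorm : bergmanENormSq α F ≤ 1) (hmax : IsMaxOn (vectorBergmanDensity α F) unitDisk 0) {t : ℝ}
    (ht : 0 < t) (htF : t ≤ ‖F 0‖ ^ 2) (hsmall : 36 * ((1 - ‖F 0‖ ^ 2) * ‖F 0‖ ^ 2) ≤ t ^ 2) :
    superlevelMeasure (vectorBergmanDensity α F) t ≤ ENNReal.ofReal
      (π * (1 + 14 * ((1 - ‖F 0‖ ^ 2) * ‖F 0‖ ^ 2) / t ^ 2) *
        ((‖F 0‖ ^ 2 / t) ^ (1 / (α + 2)) - 1)) := by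
  have hF0 : 0 < ‖F 0‖ := by
    by_contra! h
    nlinarith [norm_nonneg (F 0)]
  have hF1 : 0 ≤ 1 - ‖F 0‖ ^ 2 :=
    sub_nonneg.2 (norm_sq_zero_le_one hα hF hnorm)
  have hδ : √((1 - ‖F 0‖ ^ 2) / ‖F 0‖ ^ 2) ^ 2 = (1 - ‖F 0‖ ^ 2) / ‖F 0‖ ^ 2 :=
    sq_sqrt (by positivity)
  have hδM : 6 * (√((1 - ‖F 0‖ ^ 2) / ‖F 0‖ ^ 2) * (‖F 0‖ ^ 2 / t)) ≤ 1 := by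
    refine le_of_sq_le_sq ?_ zero_le_one
    rw [mul_pow, mul_pow, hδ]
    field_simp
    linarith
  have hdisk : unitDisk ∈ nhds 0 := isOpen_unitDisk.mem_nhds zero_mem_unitDisk
  have hcrit : inner ℂ (F 0) (deriv F 0) = 0 :=
    inner_deriv_eq_zero_of_isLocalMax (hF.differentiableAt hdisk) (hmax.isLocalMax hdisk)
  have hinner : DifferentiableOn ℂ (fun z => inner ℂ (F 0) (F z - F 0)) unitDisk :=
    (innerSL ℂ (F 0)).differentiable.comp_differentiableOn (hF.sub_const _)
  have hlevel := hyperbolicMeasure_perturbed_level_le (β := α + 2) (by linarith) (sqrt_nonneg _)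
    ((one_le_div ht).2 htF) hδM (hinner.div_const ((‖F 0‖ ^ 2 : ℝ) : ℂ)) (by simp)
    (fun z hz => ?_)
    (isOpen_superlevel_vectorBergmanDensity α t hF.continuousOn).measurableSet fun z hz => ?_
  · refine hlevel.trans_eq ?_
    rw [hδ]
    congr 4
    field_simp
  · rw [deriv_div_const, norm_div, Complex.norm_real, norm_of_nonneg (sq_nonneg _),
      ← mul_sqrt_div_sq hF0, div_mul_eq_mul_div]
    gcongr
    exact norm_deriv_inner_sub_le hα hF hnorm hcrit hz
  · have := norm_sq_lt_of_lt_vectorBergmanDensity hα hF hnorm hz.1 hz.2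
    rw [hδ, Complex.div_ofReal_re]
    field_simp
    linarith

end VectorBergmanDensity

section DiskAutomorphisms

open Set Real
open scoped ComplexConjugate

/-- The involutive automorphism of the unit disk exchanging `0` and `a`. -/
noncomputable def diskInvolution (a z : ℂ) : ℂ :=
  (a - z) / (1 - conj a * z)

lemma diskInvolution_zero (a : ℂ) : diskInvolution a 0 = a := by simp [diskInvolution]

variable {a z : ℂ}

lemma one_sub_conj_mul_re_pos (ha : a ∈ unitDisk) (hz : z ∈ unitDisk) :
    0 < (1 - conj a * z).re := by
  have hnorm : ‖conj a * z‖ < 1 := by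
    rw [norm_mul, RCLike.norm_conj]
    exact mul_lt_one_of_nonneg_of_lt_one_left (norm_nonneg a) (mem_unitDisk.1 ha)
      (mem_unitDisk.1 hz).le
  rw [Complex.sub_re, Complex.one_re, sub_pos]
  exact (Complex.re_le_norm _).trans_lt hnorm

lemma one_sub_conj_mul_ne_zero (ha : a ∈ unitDisk) (hz : z ∈ unitDisk) : 1 - conj a * z ≠ 0 :=
  fun h => (one_sub_conj_mul_re_pos ha hz).ne' (by rw [h, Complex.zero_re])

lemma one_sub_norm_diskInvolution_sq (ha : a ∈ unitDisk) (hz : z ∈ unitDisk) :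
    1 - ‖diskInvolution a z‖ ^ 2 =
      (1 - ‖a‖ ^ 2) * (1 - ‖z‖ ^ 2) / ‖1 - conj a * z‖ ^ 2 := by
  have h : 0 < ‖1 - conj a * z‖ := norm_pos_iff.2 (one_sub_conj_mul_ne_zero ha hz)
  rw [diskInvolution, norm_div, div_pow, eq_div_iff (by positivity), sub_mul,
    div_mul_cancel₀ _ (by positivity)]
  simp only [← Complex.normSq_eq_norm_sq, Complex.normSq_apply, Complex.sub_re, Complex.sub_im,
    Complex.mul_re, Complex.mul_im, Complex.conj_re, Complex.conj_im, Complex.one_re,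
    Complex.one_im]
  ring

lemma diskInvolution_mem (ha : a ∈ unitDisk) (hz : z ∈ unitDisk) :
    diskInvolution a z ∈ unitDisk := by
  have h : 0 < ‖1 - conj a * z‖ := norm_pos_iff.2 (one_sub_conj_mul_ne_zero ha hz)
  have ha' := one_sub_norm_sq_pos ha
  have hz' := one_sub_norm_sq_pos hz
  have hpos : 0 < 1 - ‖diskInvolution a z‖ ^ 2 := by
    rw [one_sub_norm_diskInvolution_sq ha hz]
    positivity
  exact mem_unitDisk.2 <| (sq_lt_one_iff₀ (norm_nonneg _)).1 (by linarith)

lemma diskInvolution_diskInvolution (ha : a ∈ unitDisk) (hz : z ∈ unitDisk) :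
    diskInvolution a (diskInvolution a z) = z := by
  have h := one_sub_conj_mul_ne_zero ha hz
  rw [diskInvolution, div_eq_iff (one_sub_conj_mul_ne_zero ha (diskInvolution_mem ha hz)),
    diskInvolution]
  generalize hq : 1 - conj a * z = q at h
  field_simp
  rw [← hq]
  ring

lemma injOn_diskInvolution (ha : a ∈ unitDisk) : InjOn (diskInvolution a) unitDisk :=
  LeftInvOn.injOn fun _ hz => diskInvolution_diskInvolution ha hz

lemma hasDerivAt_diskInvolution (ha : a ∈ unitDisk) (hz : z ∈ unitDisk) :
    HasDerivAt (diskInvolution a) (-(1 - conj a * a) / (1 - conj a * z) ^ 2) z := by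
  have hnum : HasDerivAt (fun z => a - z) (-1) z := (hasDerivAt_id z).const_sub a
  have hden : HasDerivAt (fun z => 1 - conj a * z) (-(conj a * 1)) z :=
    ((hasDerivAt_id z).const_mul (conj a)).const_sub 1
  convert! hnum.div hden (one_sub_conj_mul_ne_zero ha hz) using 1
  ring

lemma norm_deriv_diskInvolution (ha : a ∈ unitDisk) (hz : z ∈ unitDisk) :
    ‖deriv (diskInvolution a) z‖ * (1 - ‖z‖ ^ 2) = 1 - ‖diskInvolution a z‖ ^ 2 := by
  have hnorm : ‖1 - conj a * a‖ = 1 - ‖a‖ ^ 2 := by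
    rw [Complex.conj_mul', ← Complex.ofReal_pow, ← Complex.ofReal_one, ← Complex.ofReal_sub,
      Complex.norm_real, norm_of_nonneg (one_sub_norm_sq_pos ha).le]
  rw [(hasDerivAt_diskInvolution ha hz).deriv, one_sub_norm_diskInvolution_sq ha hz, norm_div,
    norm_neg, norm_pow, hnorm, div_mul_eq_mul_div]

lemma det_restrictScalars_toSpanSingleton (w : ℂ) :
    ((ContinuousLinearMap.toSpanSingleton ℂ w).restrictScalars ℝ).det = ‖w‖ ^ 2 := by
  have h := LinearMap.det_restrictScalars (R := ℝ)
    (f := (ContinuousLinearMap.toSpanSingleton ℂ w : ℂ →ₗ[ℂ] ℂ))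
  rwa [← ContinuousLinearMap.det, ContinuousLinearMap.det_toSpanSingleton,
    Algebra.norm_complex_apply, Complex.normSq_eq_norm_sq] at h

lemma lintegral_image_eq_lintegral_norm_deriv_sq_mul {φ φ' : ℂ → ℂ} {S : Set ℂ}
    (hS : MeasurableSet S) (hφ : ∀ z ∈ S, HasDerivAt φ (φ' z) z) (hinj : InjOn φ S)
    (g : ℂ → ENNReal) :
    ∫⁻ w in φ '' S, g w = ∫⁻ z in S, ENNReal.ofReal (‖φ' z‖ ^ 2) * g (φ z) := by
  rw [lintegral_image_eq_lintegral_abs_det_fderiv_mul volume hS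
    (fun z hz => ((hφ z hz).hasFDerivAt.restrictScalars ℝ).hasFDerivWithinAt) hinj]
  simp only [det_restrictScalars_toSpanSingleton, abs_pow, abs_norm]

lemma ae_hyperbolicMeasure_mem_unitDisk : ∀ᵐ z ∂hyperbolicMeasure, z ∈ unitDisk :=
  (withDensity_absolutelyContinuous _ _).ae_le (ae_restrict_mem isOpen_unitDisk.measurableSet)

lemma measurePreserving_diskInvolution (ha : a ∈ unitDisk) :
    MeasurePreserving (diskInvolution a) hyperbolicMeasure hyperbolicMeasure := by
  have hmeas : Measurable (diskInvolution a) := by unfold diskInvolution; fun_prop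
  refine ⟨hmeas, Measure.ext fun S hS => ?_⟩
  have hmeasA : MeasurableSet (diskInvolution a ⁻¹' S ∩ unitDisk) :=
    (hmeas hS).inter isOpen_unitDisk.measurableSet
  have himage : S ∩ unitDisk = diskInvolution a '' (diskInvolution a ⁻¹' S ∩ unitDisk) := by
    ext w
    refine ⟨fun hw => ⟨diskInvolution a w, ⟨?_, diskInvolution_mem ha hw.2⟩,
      diskInvolution_diskInvolution ha hw.2⟩, ?_⟩
    · rw [mem_preimage, diskInvolution_diskInvolution ha hw.2]
      exact hw.1
    · rintro ⟨z, hz, rfl⟩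
      exact ⟨hz.1, diskInvolution_mem ha hz.2⟩
  rw [Measure.map_apply hmeas hS, hyperbolicMeasure_apply hS,
    hyperbolicMeasure_apply (hmeas hS), himage,
    lintegral_image_eq_lintegral_norm_deriv_sq_mul hmeasA (fun z hz =>
      (hasDerivAt_diskInvolution ha hz.2).differentiableAt.hasDerivAt)
      ((injOn_diskInvolution ha).mono inter_subset_right)]
  refine setLIntegral_congr_fun hmeasA fun z hz => ?_
  have := one_sub_norm_sq_pos hz.2
  have hpos := one_sub_norm_sq_pos (diskInvolution_mem ha hz.2)
  rw [← norm_deriv_diskInvolution ha hz.2] at hpos ⊢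
  rw [← ENNReal.ofReal_mul (sq_nonneg _)]
  have hderiv := left_ne_zero_of_mul hpos.ne'
  field_simp

variable {E : Type*} [NormedAddCommGroup E] {F : ℂ → E}

lemma aemeasurable_vectorBergmanDensity (α : ℝ) (hF : ContinuousOn F unitDisk) :
    AEMeasurable (vectorBergmanDensity α F) hyperbolicMeasure :=
  (((hF.norm.pow 2).mul (continuousOn_one_sub_norm_sq_rpow (α + 2))).aemeasurable
    isOpen_unitDisk.measurableSet).mono_ac (withDensity_absolutelyContinuous _ _)

lemma bergmanENormSq_eq_lintegral_vectorBergmanDensity (α : ℝ) (F : ℂ → E) :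
    bergmanENormSq α F = ENNReal.ofReal ((α + 1) / π) *
      ∫⁻ z, ENNReal.ofReal (vectorBergmanDensity α F z) ∂hyperbolicMeasure := by
  have hdens : Measurable fun z : ℂ => ENNReal.ofReal (1 / (1 - ‖z‖ ^ 2) ^ 2) := by fun_prop
  rw [bergmanENormSq, hyperbolicMeasure, lintegral_withDensity_eq_lintegral_mul_non_measurable _
    hdens (Filter.Eventually.of_forall fun _ => ENNReal.ofReal_lt_top)]
  congr 1
  refine setLIntegral_congr_fun isOpen_unitDisk.measurableSet fun z hz => ?_
  have hpos := one_sub_norm_sq_pos hz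
  simp only [Pi.mul_apply, vectorBergmanDensity]
  rw [← ENNReal.ofReal_mul (by positivity), rpow_add hpos, rpow_two]
  field_simp

variable [NormedSpace ℂ E]

/-- The unitary action of `diskInvolution a` on vector-valued functions of `A²_α`, up to a
unimodular constant. -/
noncomputable def bergmanPullback (α : ℝ) (a : ℂ) (F : ℂ → E) (z : ℂ) : E :=
  (((1 - ‖a‖ ^ 2) ^ ((α + 2) / 2) : ℝ) * (1 - conj a * z) ^ ((-(α + 2) : ℝ) : ℂ)) •
    F (diskInvolution a z)

lemma differentiableOn_bergmanPullback (α : ℝ) (ha : a ∈ unitDisk)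
    (hF : DifferentiableOn ℂ F unitDisk) :
    DifferentiableOn ℂ (bergmanPullback α a F) unitDisk := by
  have hcomp : DifferentiableOn ℂ (fun z => F (diskInvolution a z)) unitDisk :=
    hF.comp (fun z hz => (hasDerivAt_diskInvolution ha hz).differentiableAt.differentiableWithinAt)
      fun z hz => diskInvolution_mem ha hz
  have hden : DifferentiableOn ℂ (fun z => 1 - conj a * z) unitDisk := by fun_prop
  exact ((hden.cpow_const fun z hz =>
    Or.inl (one_sub_conj_mul_re_pos ha hz)).const_mul _).smul hcomp

lemma vectorBergmanDensity_bergmanPullback (α : ℝ) (ha : a ∈ unitDisk) (hz : z ∈ unitDisk)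
    (F : ℂ → E) : vectorBergmanDensity α (bergmanPullback α a F) z =
      vectorBergmanDensity α F (diskInvolution a z) := by
  have h : 0 < ‖1 - conj a * z‖ := norm_pos_iff.2 (one_sub_conj_mul_ne_zero ha hz)
  have ha' := one_sub_norm_sq_pos ha
  have hz' := one_sub_norm_sq_pos hz
  have hnum : ((1 - ‖a‖ ^ 2) ^ ((α + 2) / 2)) ^ 2 = (1 - ‖a‖ ^ 2) ^ (α + 2) := by
    rw [← rpow_mul_natCast ha'.le]; congr 1; push_cast; ring
  have hden : (‖1 - conj a * z‖ ^ (-(α + 2))) ^ 2 = ((‖1 - conj a * z‖ ^ 2) ^ (α + 2))⁻¹ := by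
    rw [rpow_pow_comm h.le, rpow_neg (sq_nonneg _)]
  rw [vectorBergmanDensity, vectorBergmanDensity, one_sub_norm_diskInvolution_sq ha hz,
    div_rpow (by positivity) (by positivity), mul_rpow ha'.le hz'.le, bergmanPullback, norm_smul,
    norm_mul, Complex.norm_real, norm_of_nonneg (rpow_nonneg ha'.le _), Complex.norm_cpow_real,
    mul_pow, mul_pow, hnum, hden]
  ring

lemma bergmanENormSq_bergmanPullback (α : ℝ) (ha : a ∈ unitDisk)
    (hF : DifferentiableOn ℂ F unitDisk) :
    bergmanENormSq α (bergmanPullback α a F) = bergmanENormSq α F := by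
  have hφ := measurePreserving_diskInvolution ha
  have hmeas : AEMeasurable (fun z => ENNReal.ofReal (vectorBergmanDensity α F z))
      (hyperbolicMeasure.map (diskInvolution a)) := by
    rw [hφ.map_eq]
    exact (aemeasurable_vectorBergmanDensity α hF.continuousOn).ennreal_ofReal
  rw [bergmanENormSq_eq_lintegral_vectorBergmanDensity,
    bergmanENormSq_eq_lintegral_vectorBergmanDensity]
  congr 1
  calc ∫⁻ z, ENNReal.ofReal (vectorBergmanDensity α (bergmanPullback α a F) z) ∂hyperbolicMeasure
      = ∫⁻ z, ENNReal.ofReal (vectorBergmanDensity α F (diskInvolution a z))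
          ∂hyperbolicMeasure := lintegral_congr_ae <| by
        filter_upwards [ae_hyperbolicMeasure_mem_unitDisk] with z hz
        rw [vectorBergmanDensity_bergmanPullback α ha hz]
    _ = ∫⁻ z, ENNReal.ofReal (vectorBergmanDensity α F z)
          ∂hyperbolicMeasure.map (diskInvolution a) :=
        (lintegral_map' hmeas hφ.aemeasurable).symm
    _ = ∫⁻ z, ENNReal.ofReal (vectorBergmanDensity α F z) ∂hyperbolicMeasure := by
        rw [hφ.map_eq]

lemma superlevelMeasure_congr {u v : ℂ → ℝ} (h : EqOn u v unitDisk) (t : ℝ) :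
    superlevelMeasure u t = superlevelMeasure v t := by
  unfold superlevelMeasure
  congr 1
  ext z
  exact and_congr_right fun hz => by rw [h hz]

lemma superlevelMeasure_bergmanPullback (α t : ℝ) (ha : a ∈ unitDisk)
    (hF : DifferentiableOn ℂ F unitDisk) :
    superlevelMeasure (vectorBergmanDensity α (bergmanPullback α a F)) t =
      superlevelMeasure (vectorBergmanDensity α F) t := by
  unfold superlevelMeasure
  rw [← (measurePreserving_diskInvolution ha).measure_preimage
    (isOpen_superlevel_vectorBergmanDensity α t hF.continuousOn).measurableSet.nullMeasurableSet]
  refine measure_congr ?_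
  filter_upwards [ae_hyperbolicMeasure_mem_unitDisk] with z hz
  refine propext (and_congr (iff_of_true hz (diskInvolution_mem ha hz)) ?_)
  rw [vectorBergmanDensity_bergmanPullback α ha hz]

end DiskAutomorphisms

section SquareSummableFamilies

open Set Real Filter
open scoped Topology

section

variable {ι : Type*} {G : ι → Type*} [∀ i, NormedAddCommGroup (G i)]

lemma hasSum_norm_sq_lp (x : lp G 2) : HasSum (fun i => ‖x i‖ ^ 2) (‖x‖ ^ 2) := by
  simpa using lp.hasSum_norm (p := 2) (by norm_num) x

lemma norm_sub_sum_single_sq_le [DecidableEq ι] {x : lp G 2} {w : ι → ℝ} {b : ℝ}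
    (hw : Summable w) (h : ∀ i, ‖x i‖ ^ 2 ≤ w i * b) (s : Finset ι) :
    ‖x - ∑ i ∈ s, lp.single 2 i (x i)‖ ^ 2 ≤ (∑' i, w i - ∑ i ∈ s, w i) * b := by
  have hdiff := (hw.hasSum.mul_right b).sub (hasSum_norm_sq_lp x)
  have hle := sum_le_hasSum s (fun i _ => sub_nonneg.2 (h i)) hdiff
  have hcompl : ‖x - ∑ i ∈ s, lp.single 2 i (x i)‖ ^ 2 = ‖x‖ ^ 2 - ∑ i ∈ s, ‖x i‖ ^ 2 := by
    simpa using lp.norm_compl_sum_single (p := 2) (by norm_num) x s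
  rw [Finset.sum_sub_distrib, ← Finset.sum_mul] at hle
  linarith

variable [∀ i, NormedSpace ℂ (G i)] [∀ i, CompleteSpace (G i)] {U : Set ℂ} {w : ι → ℝ}
  {B : ℂ → ℝ}

lemma differentiableOn_lp_two {F : ℂ → lp G 2} (hU : IsOpen U)
    (hF : ∀ i, DifferentiableOn ℂ (fun z => F z i) U) (hw : Summable w) (hB : ContinuousOn B U)
    (h : ∀ z ∈ U, ∀ i, ‖F z i‖ ^ 2 ≤ w i * B z) : DifferentiableOn ℂ F U := by
  classical
  have hlim : TendstoLocallyUniformlyOn (fun s z => ∑ i ∈ s, lp.single 2 i (F z i)) F atTop U := by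
    refine tendstoLocallyUniformlyOn_iff_filter.2 fun z hz =>
      Metric.tendstoUniformlyOnFilter_iff.2 fun ε hε => ?_
    have htail : Tendsto (fun n : Finset ι × ℂ => (∑' i, w i - ∑ i ∈ n.1, w i) * B n.2)
        (atTop ×ˢ 𝓝[U] z) (𝓝 0) := by
      simpa using ((hw.hasSum.const_sub (∑' i, w i)).comp tendsto_fst).mul
        ((hB z hz).tendsto.comp tendsto_snd)
    filter_upwards [htail.eventually_lt_const (pow_pos hε 2),
      tendsto_snd.eventually self_mem_nhdsWithin] with n hn hnU
    rw [dist_eq_norm]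
    exact lt_of_pow_lt_pow_left₀ 2 hε.le
      ((norm_sub_sum_single_sq_le hw (h n.2 hnU) n.1).trans_lt hn)
  refine hlim.differentiableOn (.of_forall fun s => ?_) hU
  exact DifferentiableOn.fun_sum fun i _ =>
    (lp.singleContinuousLinearMap ℂ G 2 i).differentiable.comp_differentiableOn (hF i)

lemma exists_differentiableOn_lp_two {g : ∀ i, ℂ → G i} (hU : IsOpen U)
    (hg : ∀ i, DifferentiableOn ℂ (g i) U) (hw : Summable w) (hB : ContinuousOn B U)
    (h : ∀ z ∈ U, ∀ i, ‖g i z‖ ^ 2 ≤ w i * B z) :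
    ∃ F : ℂ → lp G 2, DifferentiableOn ℂ F U ∧ ∀ z ∈ U, ∀ i, F z i = g i z := by
  have hmem : ∀ z, ∃ x : lp G 2, z ∈ U → ∀ i, x i = g i z := fun z => by
    by_cases hz : z ∈ U
    · refine ⟨⟨fun i => g i z, memℓp_gen ?_⟩, fun _ _ => rfl⟩
      simpa using Summable.of_nonneg_of_le (fun i => sq_nonneg _) (h z hz) (hw.mul_right _)
    · exact ⟨0, fun hz' => absurd hz' hz⟩
  choose F hF using hmem
  refine ⟨F, differentiableOn_lp_two hU (fun i => (hg i).congr fun z hz => hF z hz i) hw hB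
    fun z hz i => ?_, hF⟩
  rw [hF z hz]
  exact h z hz i

end

lemma bergmanENormSq_eq_ofReal_mul {E E' : Type*} [NormedAddCommGroup E] [NormedAddCommGroup E']
    (α : ℝ) {F : ℂ → E} {F' : ℂ → E'} {c : ℝ} (hc : 0 ≤ c)
    (h : ∀ z ∈ unitDisk, ‖F z‖ ^ 2 = c * ‖F' z‖ ^ 2) :
    bergmanENormSq α F = ENNReal.ofReal c * bergmanENormSq α F' := by
  rw [bergmanENormSq, bergmanENormSq, mul_left_comm,
    ← lintegral_const_mul' (ENNReal.ofReal c) _ ENNReal.ofReal_ne_top]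
  congr 1
  refine setLIntegral_congr_fun isOpen_unitDisk.measurableSet fun z hz => ?_
  rw [← ENNReal.ofReal_mul hc, h z hz, mul_assoc]

lemma bergmanENormSq_lp_two {ι : Type*} [Countable ι] {G : ι → Type*}
    [∀ i, NormedAddCommGroup (G i)] (α : ℝ) {F : ℂ → lp G 2}
    (hF : ∀ i, ContinuousOn (fun z => F z i) unitDisk) :
    bergmanENormSq α F = ∑' i, bergmanENormSq α fun z => F z i := by
  have hmeas : ∀ i, AEMeasurable
      (fun z => ENNReal.ofReal (‖F z i‖ ^ 2 * (1 - ‖z‖ ^ 2) ^ α)) (volume.restrict unitDisk) :=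
    fun i => (((hF i).norm.pow 2).mul (continuousOn_one_sub_norm_sq_rpow α)).aemeasurable
      isOpen_unitDisk.measurableSet |>.ennreal_ofReal
  simp only [bergmanENormSq]
  rw [ENNReal.tsum_mul_left, ← lintegral_tsum hmeas]
  congr 1
  refine setLIntegral_congr_fun isOpen_unitDisk.measurableSet fun z hz => ?_
  have hsum := (hasSum_norm_sq_lp (F z)).mul_right ((1 - ‖z‖ ^ 2) ^ α)
  have hpos := rpow_nonneg (one_sub_norm_sq_pos hz).le α
  rw [← hsum.tsum_eq, ENNReal.ofReal_tsum_of_nonneg (fun i => mul_nonneg (sq_nonneg _) hpos)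
    hsum.summable]

lemma norm_sq_le_rpow_of_bergmanENormSq_le_one {E : Type*} [NormedAddCommGroup E]
    [InnerProductSpace ℂ E] [CompleteSpace E] {α : ℝ} (hα : -1 < α) {F : ℂ → E}
    (hF : DifferentiableOn ℂ F unitDisk) (hnorm : bergmanENormSq α F ≤ 1) {z : ℂ}
    (hz : z ∈ unitDisk) : ‖F z‖ ^ 2 ≤ (1 - ‖z‖ ^ 2) ^ (-(α + 2)) := by
  refine (norm_sq_le_tsum_taylorTermNormSq_mul (by linarith) hF
    (summable_taylorTermNormSq hα hF hnorm) hz).trans (mul_le_of_le_one_left ?_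
    (tsum_taylorTermNormSq_le_one hα hF hnorm))
  exact rpow_nonneg (one_sub_norm_sq_pos hz).le _

theorem exists_vectorBergmanDensity_eqOn_covariantSymbol {α : ℝ} (hα : -1 < α) {p : ℕ → ℝ}
    {f : ℕ → ℂ → ℂ} (hp : ∀ j, 0 ≤ p j) (hsum : HasSum p 1)
    (hf : ∀ j, DifferentiableOn ℂ (f j) unitDisk) (hnorm : ∀ j, bergmanENormSq α (f j) = 1) :
    ∃ F : ℂ → lp (fun _ : ℕ => ℂ) 2, DifferentiableOn ℂ F unitDisk ∧ bergmanENormSq α F = 1 ∧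
      EqOn (vectorBergmanDensity α F) (covariantSymbol α p f) unitDisk := by
  have hnormsq : ∀ j z, ‖(√(p j) : ℂ) * f j z‖ ^ 2 = p j * ‖f j z‖ ^ 2 := fun j z => by
    rw [norm_mul, mul_pow, Complex.norm_real, norm_of_nonneg (sqrt_nonneg _), sq_sqrt (hp j)]
  have hgrowth : ∀ z ∈ unitDisk, ∀ j,
      ‖(√(p j) : ℂ) * f j z‖ ^ 2 ≤ p j * (1 - ‖z‖ ^ 2) ^ (-(α + 2)) := fun z hz j => by
    rw [hnormsq]
    exact mul_le_mul_of_nonneg_left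
      (norm_sq_le_rpow_of_bergmanENormSq_le_one hα (hf j) (hnorm j).le hz) (hp j)
  obtain ⟨F, hF, hFf⟩ := exists_differentiableOn_lp_two isOpen_unitDisk
    (fun j => (hf j).const_mul (√(p j) : ℂ)) hsum.summable
    (continuousOn_one_sub_norm_sq_rpow (-(α + 2))) hgrowth
  have hcoord : ∀ j, ∀ z ∈ unitDisk, ‖F z j‖ ^ 2 = p j * ‖f j z‖ ^ 2 := fun j z hz => by
    rw [hFf z hz, hnormsq]
  have hcont : ∀ j, ContinuousOn (fun z => F z j) unitDisk := fun j =>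
    ((hf j).continuousOn.const_mul (√(p j) : ℂ)).congr fun z hz => hFf z hz j
  refine ⟨F, hF, ?_, fun z hz => ?_⟩
  · simp_rw [bergmanENormSq_lp_two α hcont, bergmanENormSq_eq_ofReal_mul α (hp _) (hcoord _),
      hnorm, mul_one]
    rw [← ENNReal.ofReal_tsum_of_nonneg hp hsum.summable, hsum.tsum_eq, ENNReal.ofReal_one]
  · rw [vectorBergmanDensity, ← (hasSum_norm_sq_lp (F z)).tsum_eq, ← tsum_mul_right,
      covariantSymbol]
    exact tsum_congr fun j => by rw [hcoord j z hz, bergmanDensity, mul_assoc]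

end SquareSummableFamilies

section DistributionFunction

open Set Real

variable {E : Type*} [NormedAddCommGroup E] {α T t : ℝ} {F : ℂ → E}

lemma exists_bergmanPullback_isMaxOn_zero [NormedSpace ℂ E]
    (hF : DifferentiableOn ℂ F unitDisk)
    (hT : IsGreatest (vectorBergmanDensity α F '' unitDisk) T) :
    ∃ G : ℂ → E, DifferentiableOn ℂ G unitDisk ∧ bergmanENormSq α G = bergmanENormSq α F ∧
      ‖G 0‖ ^ 2 = T ∧ IsMaxOn (vectorBergmanDensity α G) unitDisk 0 ∧
      ∀ t, superlevelMeasure (vectorBergmanDensity α G) t =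
        superlevelMeasure (vectorBergmanDensity α F) t := by
  obtain ⟨⟨a, ha, haT⟩, hub⟩ := hT
  have hzero : vectorBergmanDensity α (bergmanPullback α a F) 0 = T := by
    rw [vectorBergmanDensity_bergmanPullback α ha zero_mem_unitDisk, diskInvolution_zero, haT]
  refine ⟨bergmanPullback α a F, differentiableOn_bergmanPullback α ha hF,
    bergmanENormSq_bergmanPullback α ha hF, ?_, isMaxOn_iff.2 fun z hz => ?_,
    fun t => superlevelMeasure_bergmanPullback α t ha hF⟩
  · rw [← vectorBergmanDensity_zero α, hzero]
  · rw [hzero, vectorBergmanDensity_bergmanPullback α ha hz]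
    exact hub ⟨_, diskInvolution_mem ha hz, rfl⟩

variable [InnerProductSpace ℂ E] [CompleteSpace E]

theorem superlevelMeasure_vectorBergmanDensity_le (hα : -1 < α)
    (hF : DifferentiableOn ℂ F unitDisk) (hnorm : bergmanENormSq α F ≤ 1)
    (hT : IsGreatest (vectorBergmanDensity α F '' unitDisk) T) (ht : 0 < t) (htT : t ≤ T)
    (hsmall : 36 * ((1 - T) * T) ≤ t ^ 2) :
    superlevelMeasure (vectorBergmanDensity α F) t ≤ ENNReal.ofReal
      (π * (1 + 14 * ((1 - T) * T) / t ^ 2) * ((T / t) ^ (1 / (α + 2)) - 1)) := by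
  obtain ⟨G, hG, hGF, rfl, hmax, hmeas⟩ := exists_bergmanPullback_isMaxOn_zero hF hT
  rw [← hmeas]
  exact superlevelMeasure_le_of_isMaxOn_zero hα hG (hGF.trans_le hnorm) hmax ht htT hsmall

lemma le_one_of_isGreatest_vectorBergmanDensity (hα : -1 < α)
    (hF : DifferentiableOn ℂ F unitDisk) (hnorm : bergmanENormSq α F ≤ 1)
    (hT : IsGreatest (vectorBergmanDensity α F '' unitDisk) T) : T ≤ 1 := by
  obtain ⟨G, hG, hGF, rfl, -⟩ := exists_bergmanPullback_isMaxOn_zero hF hT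
  exact norm_sq_zero_le_one hα hG (hGF.trans_le hnorm)

lemma one_add_mul_div_sq_le {c t₀ : ℝ} (hc : 0 ≤ c) (ht₀ : 0 < t₀) (ht₁ : t₀ ≤ 1) (ht : t₀ ≤ t)
    (hT : 0 < T) (hT₁ : T ≤ 1) :
    1 + c * ((1 - T) * T) / t ^ 2 ≤ (1 + c * t₀ ^ (-3 : ℤ) * (1 - T)) / T := by
  have : 0 ≤ 1 - T := sub_nonneg.2 hT₁
  have htpos : 0 < t := ht₀.trans_le ht
  have hsq : T * t₀ ^ 3 ≤ t ^ 2 :=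
    calc T * t₀ ^ 3 ≤ 1 * t₀ ^ 2 :=
          mul_le_mul hT₁ (pow_le_pow_of_le_one ht₀.le ht₁ (by norm_num)) (by positivity) zero_le_one
      _ ≤ t ^ 2 := by rw [one_mul]; gcongr
  have hinv : T / t ^ 2 ≤ t₀ ^ (-3 : ℤ) := by
    rw [zpow_neg, ← one_div, div_le_div_iff₀ (by positivity) (by positivity), one_mul]
    exact_mod_cast hsq
  calc 1 + c * ((1 - T) * T) / t ^ 2 = 1 + c * (T / t ^ 2) * (1 - T) := by ring
    _ ≤ 1 + c * t₀ ^ (-3 : ℤ) * (1 - T) := by gcongr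
    _ ≤ (1 + c * t₀ ^ (-3 : ℤ) * (1 - T)) / T := le_div_self (by positivity) hT hT₁

theorem mainTheorem5_general.{u} :
    ∃ C : ℝ, 0 < C ∧
      ∀ t₀ : ℝ, 0 < t₀ → t₀ < 1 →
        ∃ T₀ : ℝ, t₀ < T₀ ∧ T₀ < 1 ∧
          ∀ α : ℝ, -1 < α →
            ∀ (E : Type u) [NormedAddCommGroup E] [InnerProductSpace ℂ E] [CompleteSpace E]
              (F : ℂ → E), DifferentiableOn ℂ F unitDisk → bergmanENormSq α F ≤ 1 →
              ∀ T : ℝ, IsGreatest (vectorBergmanDensity α F '' unitDisk) T → T₀ ≤ T →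
                ∀ t : ℝ, t₀ < t → t < T →
                  superlevelMeasure (vectorBergmanDensity α F) t ≤
                    ENNReal.ofReal (π * ((1 + C * t₀ ^ (-3 : ℤ) * (1 - T)) / T) *
                      ((T / t) ^ (1 / (α + 2)) - 1)) := by
  refine ⟨14, by norm_num, fun t₀ ht₀ ht₁ => ⟨1 - t₀ ^ 2 * (1 - t₀) / 36, ?_, ?_, ?_⟩⟩
  · have := mul_lt_of_lt_one_left (sub_pos.2 ht₁) (pow_lt_one₀ ht₀.le ht₁ two_ne_zero)
    linarith
  · have := mul_pos (pow_pos ht₀ 2) (sub_pos.2 ht₁)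
    linarith
  intro α hα E _ _ _ F hF hnorm T hT hT₀ t ht htT
  have htpos : 0 < t := ht₀.trans ht
  have hTpos : 0 < T := htpos.trans htT
  have hT₁ : T ≤ 1 := le_one_of_isGreatest_vectorBergmanDensity hα hF hnorm hT
  have hsmall : 36 * ((1 - T) * T) ≤ t ^ 2 :=
    calc 36 * ((1 - T) * T) ≤ 36 * (1 - T) := by nlinarith
      _ ≤ t₀ ^ 2 := by nlinarith [pow_pos ht₀ 3]
      _ ≤ t ^ 2 := by gcongr
  have hroot : 0 ≤ (T / t) ^ (1 / (α + 2)) - 1 := sub_nonneg.2 <|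
    one_le_rpow ((one_le_div htpos).2 htT.le) (one_div_nonneg.2 (by linarith))
  refine (superlevelMeasure_vectorBergmanDensity_le hα hF hnorm hT htpos htT.le hsmall).trans ?_
  gcongr
  exact one_add_mul_div_sq_le (by norm_num) ht₀ ht₁.le ht.le hTpos hT₁

end DistributionFunction

theorem mainTheorem5 :
    ∃ C : ℝ, 0 < C ∧
      ∀ t₀ : ℝ, 0 < t₀ → t₀ < 1 →
        ∃ T₀ : ℝ, t₀ < T₀ ∧ T₀ < 1 ∧
          ∀ α : ℝ, -1 < α →
            -- a single function of norm one
            (∀ f : ℂ → ℂ, MemBergman α f → bergmanNorm α f = 1 →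
              ∀ T : ℝ, IsGreatest (bergmanDensity α f '' unitDisk) T → T₀ ≤ T →
                ∀ t : ℝ, t₀ < t → t < T →
                  superlevelMeasure (bergmanDensity α f) t ≤
                    ENNReal.ofReal (Real.pi * ((1 + C * t₀ ^ (-3 : ℤ) * (1 - T)) / T) *
                      ((T / t) ^ (1 / (α + 2)) - 1))) ∧
            -- a positive semi-definite operator of trace one
            -- (orthogonality of the functions `f j` is not required)
            (∀ (p : ℕ → ℝ) (f : ℕ → ℂ → ℂ), (∀ j, 0 ≤ p j) → HasSum p 1 →
              (∀ j, MemBergman α (f j)) → (∀ j, bergmanNorm α (f j) = 1) →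
              ∀ T : ℝ, IsGreatest (covariantSymbol α p f '' unitDisk) T → T₀ ≤ T →
                ∀ t : ℝ, t₀ < t → t < T →
                  superlevelMeasure (covariantSymbol α p f) t ≤
                    ENNReal.ofReal (Real.pi * ((1 + C * t₀ ^ (-3 : ℤ) * (1 - T)) / T) *
                      ((T / t) ^ (1 / (α + 2)) - 1))) := by
  obtain ⟨C, hC, hCT⟩ := mainTheorem5_general
  refine ⟨C, hC, fun t₀ ht₀ ht₁ => ?_⟩
  obtain ⟨T₀, hT₀, hT₁, hbound⟩ := hCT t₀ ht₀ ht₁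
  refine ⟨T₀, hT₀, hT₁, fun α hα => ⟨fun f hf hnorm => ?_, fun p f hp hsum hf hnorm T hT => ?_⟩⟩
  · exact hbound α hα ℂ f hf.1 (bergmanENormSq_eq_one_of_bergmanNorm_eq_one hα hf hnorm).le
  · obtain ⟨F, hF, hFnorm, hFu⟩ := exists_vectorBergmanDensity_eqOn_covariantSymbol hα hp hsum
      (fun j => (hf j).1) fun j => bergmanENormSq_eq_one_of_bergmanNorm_eq_one hα (hf j) (hnorm j)
    simp only [← superlevelMeasure_congr hFu]
    rw [← hFu.image_eq] at hT
    exact hbound α hα _ F hF hFnorm.le T hT
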